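/- Let $P\subseteq\{3,4,5,\dots\}$ be a nonempty set and let $L_P=\{E_n: n\ge 1\}\cup\{<_n: n\in P\}$ be the relational language in which $E_n$ and $<_n$ have arity $2n$. Let $\mathcal K_P$ be the class of all finite $L_P$-structures $C$ such that for every $n\ge 1$ the relation $E_n(\bar x,\bar y)$ is an equivalence relation on the set $\binom{C}{n}$ of unordered $n$-element subsets of $C$ (viewed as a relation between $n$-tuples without repetitions; it fails for tuples with repetitions), and for every $n\in P$ the relation $<_n$ (also holding only between tuples without repetitions) is a strict linear order on the set $\binom{C}{n}/E_n$ of $E_n$-classes. Let $M$ be the generic structure of $\mathcal K_P$, i.e. its Fraïssé limit: the countable ultrahomogeneous $L_P$-structure whose age is $\mathcal K_P$. Automorphism groups carry the topology of pointwise convergence. A topological group $G$ is amenable if every $G$-flow (a nonempty compact Hausdorff space with a continuous $G$-action) has an invariant (regular) Borel probability measure, and extremely amenable if every $G$-flow has a fixed point. A structure $U$ has Hrushovski's extension property if for every finite family of isomorphisms between finite substructures of $U$ there is a finite substructure $F$ of $U$ containing all these substructures such that every member of the family extends to an automorphism of $F$. Then: 1. the group $\mathrm{Aut}(M)$ is amenable;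 2. $M$ does not have Hrushovski's extension property; 3. there is no linear order $<$ on $M$ such that $(M,<)$ is ultrahomogeneous and $\mathrm{Aut}(M,<)$ is extremely amenable; 4. let $M'$ be an expansion of $M$ to a relational language containing $L_P$ which is precompact (every member of $\mathcal K_P$ has only finitely many expansions in the age of $M'$) and has quantifier elimination. If $\mathrm{Aut}(M')$ is extremely amenable, then for every $n\in P$ with $2n\notin P$ the structure $M'$ has no $<_n$-increasing sequence of type $\mathbb Z/4\mathbb Z$, that is, there are no $n$-tuples $\bar a_1,\dots,\bar a_6$ in $M$ such that - the $2n$-tuples $\bar a_1\bar a_2$, $\bar a_2\bar a_3$ and $\bar a_3\bar a_4$ have the same isomorphism type in $M'$, - the $4n$-tuples $\bar a_1\bar a_2\bar a_3\bar a_4$ and $\bar a_3\bar a_4\bar a_5\bar a_6$ have the same isomorphism type in $M'$, and - $\bar a_1\bar a_2$ and $\bar a_5\bar a_6$ are $E_{2n}$-equivalent, but not $E_{2n}$-equivalent to $\bar a_3\bar a_4$. (Two tuples have the same isomorphism type in $M'$ if mapping each entry of the first to the corresponding entry of the second is an isomorphism between the substructures of $M'$ that they form.) -/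

import Mathlib

open FirstOrder FirstOrder.Language

universe u v w x y

namespace GenericOrders

/-! ### Automorphism groups as topological groups -/

/-- The automorphism group of a first-order structure. -/
abbrev Aut (L : FirstOrder.Language.{u, v}) (M : Type w) [L.Structure M] : Type w := M ≃[L] M

instance autGroup (L : FirstOrder.Language.{u, v}) (M : Type w) [L.Structure M] : Group (Aut L M) where
  mul g h := g.comp h
  one := FirstOrder.Language.Equiv.refl L M
  inv g := g.symm
  mul_assoc _ _ _ := rfl
  one_mul _ := rfl
  mul_one _ := rfl
  inv_mul_cancel g := FirstOrder.Language.Equiv.symm_comp_self g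

/-- The topology of pointwise convergence, the underlying set of `M` being discrete: the sets
`{g | g a = b}` form a subbase. -/
instance autTopology (L : FirstOrder.Language.{u, v}) (M : Type w) [L.Structure M] :
    TopologicalSpace (Aut L M) :=
  TopologicalSpace.generateFrom {U | ∃ a b : M, U = {g : Aut L M | g a = b}}

/-- `G` is amenable: every `G`-flow (a nonempty compact Hausdorff space with a continuous action
of `G`) carries an invariant (regular) Borel probability measure. -/
def IsAmenable (G : Type w) [Group G] [TopologicalSpace G] : Prop :=
  ∀ (X : Type x) [TopologicalSpace X] [CompactSpace X] [T2Space X] [Nonempty X]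
    [MeasurableSpace X] [BorelSpace X] [MulAction G X] [ContinuousSMul G X],
    ∃ μ : MeasureTheory.Measure X, MeasureTheory.IsProbabilityMeasure μ ∧ μ.Regular ∧
      ∀ g : G, μ.map (fun p => g • p) = μ

/-- `G` is extremely amenable: every `G`-flow has a fixed point. -/
def IsExtremelyAmenable (G : Type w) [Group G] [TopologicalSpace G] : Prop :=
  ∀ (X : Type x) [TopologicalSpace X] [CompactSpace X] [T2Space X] [Nonempty X]
    [MulAction G X] [ContinuousSMul G X], ∃ p : X, ∀ g : G, g • p = p

/-! ### Model-theoretic notions -/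

/-- Hrushovski's extension property: for every finite family of isomorphisms between finite
substructures of `M` there is a finite substructure `F` of `M` containing all these substructures
such that every member of the family extends to an automorphism of `F`. -/
def HrushovskiExtension (L : FirstOrder.Language.{u, v}) (M : Type w) [L.Structure M] : Prop :=
  ∀ (k : ℕ) (f : Fin k → (M ≃ₚ[L] M)), (∀ i, Finite (f i).dom) →
    ∃ F : L.Substructure M, Finite F ∧
      ∀ i, (f i).dom ≤ F ∧ (f i).cod ≤ F ∧
        ∃ g : F ≃[L] F, ∀ (a : F) (ha : (a : M) ∈ (f i).dom),
          ((g a : F) : M) = ((f i).toEquiv ⟨a, ha⟩ : M)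

/-- `M` has quantifier elimination: every formula is equivalent in `M` (equivalently, modulo the
complete theory of `M`) to a quantifier-free formula in the same free variables. -/
def HasQE (L : FirstOrder.Language.{u, v}) (M : Type w) [L.Structure M] : Prop :=
  ∀ (k : ℕ) (φ : L.Formula (Fin k)), ∃ ψ : L.Formula (Fin k),
    BoundedFormula.IsQF ψ ∧ ∀ a : Fin k → M, φ.Realize a ↔ ψ.Realize a

/-- For an expansion of the `L`-structure `M` to an `L'`-structure along `φ : L →ᴸ L'`:
every member of the age of `M` has only finitely many expansions in the age of the expanded
structure. -/
def IsPrecompactExpansion {L : FirstOrder.Language.{u, v}} {L' : FirstOrder.Language.{x, y}} (φ : L →ᴸ L')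
    (M : Type w) [L.Structure M] [L'.Structure M] : Prop :=
  ∀ A ∈ L.age M,
    {S : L'.Structure A | @LHom.IsExpansionOn L L' φ A A.str S ∧
      (⟨A, S⟩ : CategoryTheory.Bundled.{w} L'.Structure) ∈ L'.age M}.Finite

/-- The tuples `a` and `b` have the same isomorphism type: `a i ↦ b i` is a well-defined
isomorphism between the substructures generated by the two tuples. -/
def SameIsoType (L : FirstOrder.Language.{u, v}) {M : Type w} [L.Structure M] {k : ℕ}
    (a b : Fin k → M) : Prop :=
  ∃ e : Substructure.closure L (Set.range a) ≃[L] Substructure.closure L (Set.range b),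
    ∀ i, ((e ⟨a i, Substructure.subset_closure (Set.mem_range_self i)⟩ :
      Substructure.closure L (Set.range b)) : M) = b i

/-- The expansion of an `L`-structure by a linear order. -/
abbrev orderExpansion (L : FirstOrder.Language.{u, v}) (M : Type w) [L.Structure M] (o : LinearOrder M) :
    (L.sum FirstOrder.Language.order).Structure M :=
  letI : FirstOrder.Language.order.Structure M := @FirstOrder.Language.orderStructure M o.toLE
  FirstOrder.Language.sumStructure L FirstOrder.Language.order M

/-! ### The language, the class of finite structures -/

/-- The symbols `E_n` (`n > 0`) and `<_n` (`n ∈ P`), both of arity `n + n`. -/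
inductive Rel (P : Set ℕ) : ℕ → Type
  | E (n : ℕ) (hn : 0 < n) : Rel P (n + n)
  | lt (n : ℕ) (hn : n ∈ P) : Rel P (n + n)

/-- The relational language `{E_n : n > 0} ∪ {<_n : n ∈ P}`. -/
def langP (P : Set ℕ) : FirstOrder.Language.{0, 0} := ⟨fun _ => Empty, Rel P⟩

instance langP_isRelational (P : Set ℕ) : (langP P).IsRelational :=
  fun _ => inferInstanceAs (IsEmpty Empty)

/-- `E_n(x, y)` for `n`-tuples `x`, `y`. -/
def relE (P : Set ℕ) {C : Type w} [(langP P).Structure C] (n : ℕ) (hn : 0 < n)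
    (s t : Fin n → C) : Prop :=
  Structure.RelMap (L := langP P) (Rel.E n hn : (langP P).Relations (n + n)) (Fin.append s t)

/-- `s <_n t` for `n`-tuples `s`, `t`. -/
def relLt (P : Set ℕ) {C : Type w} [(langP P).Structure C] (n : ℕ) (hn : n ∈ P)
    (s t : Fin n → C) : Prop :=
  Structure.RelMap (L := langP P) (Rel.lt n hn : (langP P).Relations (n + n)) (Fin.append s t)

/-- `R` is (the lift to `n`-tuples without repetitions of) an equivalence relation on the set of
unordered `n`-element subsets of `C`; it does not hold for tuples with repetitions. -/
structure IsEquivOnSubsets {C : Type w} {n : ℕ} (R : (Fin n → C) → (Fin n → C) → Prop) :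
    Prop where
  inj : ∀ s t, R s t → Function.Injective s ∧ Function.Injective t
  perm : ∀ s, Function.Injective s → ∀ σ : Equiv.Perm (Fin n), R s (s ∘ σ)
  symm : ∀ s t, R s t → R t s
  trans : ∀ s t r, R s t → R t r → R s r

/-- `lt` is (the lift to `n`-tuples without repetitions of) a strict linear order on the set of
classes of `R`. -/
structure IsLinearOrderOnClasses {C : Type w} {n : ℕ} (R lt : (Fin n → C) → (Fin n → C) → Prop) :
    Prop where
  inj : ∀ s t, lt s t → Function.Injective s ∧ Function.Injective t
  respects : ∀ s t p q, R s t → R p q → lt s p → lt t q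
  irrefl : ∀ s t, lt s t → ¬ R s t
  trans : ∀ s t r, lt s t → lt t r → lt s r
  total : ∀ s t, Function.Injective s → Function.Injective t → ¬ R s t → lt s t ∨ lt t s

/-- The class of all finite structures in which each `E_n` is an equivalence relation on the set
of unordered `n`-element subsets, and each `<_n`, `n ∈ P`, is a linear order on the set of
`E_n`-classes. -/
def classK (P : Set ℕ) (hP : ∀ n ∈ P, 3 ≤ n) :
    Set (CategoryTheory.Bundled.{w} (langP P).Structure) :=
  {C | Finite C ∧
    (∀ (n : ℕ) (hn : 0 < n), IsEquivOnSubsets (relE P (C := C) n hn)) ∧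
    (∀ (n : ℕ) (hn : n ∈ P), IsLinearOrderOnClasses
      (relE P (C := C) n (Nat.lt_of_lt_of_le (by decide) (hP n hn))) (relLt P (C := C) n hn))}

/-- In an `L'`-expansion of the `langP P`-structure `M`, the six `n`-tuples `a 0, …, a 5` form a
`<_n`-increasing sequence of type `ℤ/4ℤ`; isomorphism types are taken in `L'`, concatenation of
tuples is `Fin.append`. -/
def IsIncreasingZ4 (P : Set ℕ) (L' : FirstOrder.Language.{x, y}) {M : Type w} [(langP P).Structure M]
    [L'.Structure M] (n : ℕ) (hn : 0 < n) (a : Fin 6 → (Fin n → M)) : Prop :=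
  SameIsoType L' (Fin.append (a 0) (a 1)) (Fin.append (a 1) (a 2)) ∧
  SameIsoType L' (Fin.append (a 1) (a 2)) (Fin.append (a 2) (a 3)) ∧
  SameIsoType L' (Fin.append (Fin.append (a 0) (a 1)) (Fin.append (a 2) (a 3)))
    (Fin.append (Fin.append (a 2) (a 3)) (Fin.append (a 4) (a 5))) ∧
  relE P (n + n) (Nat.add_pos_left hn n) (Fin.append (a 0) (a 1)) (Fin.append (a 4) (a 5)) ∧
  ¬ relE P (n + n) (Nat.add_pos_left hn n) (Fin.append (a 0) (a 1)) (Fin.append (a 2) (a 3))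

end GenericOrders

open GenericOrders

/-!
A finite member of the class is the same as a labelling of the subsets of a finite set `B`, where
only equality of labels matters at the sizes outside `P` and the order of the labels matters at the
sizes in `P`.

*Amenability.* Give each point of `B` a value in a finite abelian group `R` for every subset of `B`,
and label a set of such valued points by the sum of the values at its projection to `B`. Every
labelling of `B` in `R` is realized by a copy of `B`, and every label preserving map between copies
of subsets of `B` extends to a label preserving permutation of all valued points. Hence the average
of a bounded function of tuples over these permutations depends only on the labelling of the tuple.
By Ramsey's theorem the labels can be chosen such that it depends, up to `ε`, only on the order type
of that labelling, and averaging over all permutations of the labels at the sizes outside `P` makes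
it depend only on the isomorphism type. Embedding the valued points into `M` produces almost
invariant finite averages on every flow, and a limit of these is an invariant measure.

*Extension property.* An automorphism of a finite structure has finite order, so it cannot move a
tuple upwards with respect to `<_n`, although a partial isomorphism of `M` can.

*Extreme amenability.* Let `H` be an open subgroup of an extremely amenable group `G`. Then `G`
fixes a tournament on `G ⧸ H`, so no element interchanges two cosets, and `g * g ∈ H` implies
`g ∈ H`. For the stabilizer of an `E_n`-class this says that an automorphism `g` with `g (g s)`
equivalent to `s` satisfies `g s` equivalent to `s`. A sequence of type `ℤ/4ℤ` violates this,
because a precompact expansion with quantifier elimination is ultrahomogeneous. For an ordered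
expansion it first shows that the `E_1`-classes are convex; then three edges in successive
`E_1`-classes, the first and the third `E_2`-equivalent and the second not, are moved one to the
next by an automorphism.
-/

namespace GenericOrders

open scoped BigOperators CompactlySupported

/-! ### Invariant measures from almost invariant averages -/

section InvariantMeasure

open Filter Topology MeasureTheory

variable {G X : Type*} [Group G] [TopologicalSpace X] [CompactSpace X]

lemma exists_abs_le (f : C_c(X, ℝ)) : ∃ C, ∀ p, |f p| ≤ C := by
  obtain ⟨C, hC⟩ := (isCompact_range f.continuous).isBounded.exists_norm_le
  exact ⟨C, fun p => hC _ (Set.mem_range_self p)⟩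

lemma exists_forall_mem_abs_le (Φ : Finset C_c(X, ℝ)) : ∃ C, ∀ f ∈ Φ, ∀ p, |f p| ≤ C := by
  classical
  choose C hC using fun f : C_c(X, ℝ) => exists_abs_le f
  obtain ⟨K, hK⟩ := (Φ.image C).exists_le
  exact ⟨K, fun f hf p => (hC f p).trans (hK _ (Finset.mem_image_of_mem C hf))⟩

lemma abs_expect_le_of_forall_abs_le {I : Type*} [Fintype I] [Nonempty I] {f : I → ℝ} {C : ℝ}
    (h : ∀ i, |f i| ≤ C) : |𝔼 i, f i| ≤ C :=
  (Finset.abs_expect_le _ f).trans (Finset.expect_le Finset.univ_nonempty fun i _ => h i)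

lemma exists_tendsto_expect {J : Type*} (U : Ultrafilter J) {I : J → Type*} [∀ j, Fintype (I j)]
    [∀ j, Nonempty (I j)] (y : ∀ j, I j → X) :
    ∃ Λ : C_c(X, ℝ) →ₚ[ℝ] ℝ, ∀ f, Tendsto (fun j => 𝔼 i, f (y j i)) U (𝓝 (Λ f)) := by
  have hlim : ∀ f : C_c(X, ℝ), ∃ l : ℝ, Tendsto (fun j => 𝔼 i, f (y j i)) U (𝓝 l) := by
    intro f
    obtain ⟨C, hC⟩ := exists_abs_le f
    have hmem : ∀ j, 𝔼 i, f (y j i) ∈ Set.Icc (-C) C := fun j =>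
      abs_le.1 (abs_expect_le_of_forall_abs_le fun i => hC (y j i))
    obtain ⟨l, -, hl⟩ := isCompact_Icc.ultrafilter_le_nhds (U.map fun j => 𝔼 i, f (y j i))
      (le_principal_iff.2 (mem_map.2 (univ_mem' hmem)))
    exact ⟨l, hl⟩
  choose l hl using hlim
  let Λ : C_c(X, ℝ) →ₗ[ℝ] ℝ :=
    { toFun := l
      map_add' := fun f g => tendsto_nhds_unique (hl (f + g)) <| by
        simpa [Finset.expect_add_distrib] using (hl f).add (hl g)
      map_smul' := fun c f => tendsto_nhds_unique (hl (c • f)) <| by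
        simpa [Finset.mul_expect] using (hl f).const_mul c }
  exact ⟨PositiveLinearMap.mk₀ Λ fun f hf => ge_of_tendsto (hl f) <|
    Eventually.of_forall fun j => Finset.expect_nonneg fun i _ => hf (y j i), hl⟩

variable [T2Space X] [MeasurableSpace X] [BorelSpace X]

lemma isProbabilityMeasure_rieszMeasure (Λ : C_c(X, ℝ) →ₚ[ℝ] ℝ)
    (hΛ : ∀ f : C_c(X, ℝ), (∀ p, f p = 1) → Λ f = 1) :
    IsProbabilityMeasure (RealRMK.rieszMeasure Λ) := by
  let o : C_c(X, ℝ) := ⟨1, HasCompactSupport.of_compactSpace 1⟩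
  have ho : ∀ p, o p = 1 := fun _ => rfl
  have h := RealRMK.integral_rieszMeasure Λ o
  simp only [hΛ o ho, ho, integral_const, smul_eq_mul, mul_one, measureReal_def] at h
  exact ⟨(ENNReal.toReal_eq_one_iff _).1 h⟩

lemma map_smul_rieszMeasure [MulAction G X] [ContinuousConstSMul G X] (Λ : C_c(X, ℝ) →ₚ[ℝ] ℝ)
    (g : G) (hΛ : ∀ f f' : C_c(X, ℝ), (∀ p, f' p = f (g • p)) → Λ f' = Λ f) :
    (RealRMK.rieszMeasure Λ).map (fun p => g • p) = RealRMK.rieszMeasure Λ := by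
  have hg : Continuous fun p : X => g • p := continuous_const_smul g
  have : ((RealRMK.rieszMeasure Λ).map fun p => g • p).Regular :=
    Measure.Regular.map (Homeomorph.smul g)
  refine Measure.ext_of_integral_eq_on_compactlySupported fun f => ?_
  rw [integral_map hg.aemeasurable (map_continuous f).aestronglyMeasurable]
  let f' : C_c(X, ℝ) := ⟨⟨fun p => f (g • p), f.continuous.comp hg⟩,
    HasCompactSupport.of_compactSpace _⟩
  calc ∫ p, f (g • p) ∂(RealRMK.rieszMeasure Λ) = Λ f' := RealRMK.integral_rieszMeasure Λ f'
    _ = Λ f := hΛ f f' fun _ => rfl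
    _ = ∫ p, f p ∂(RealRMK.rieszMeasure Λ) := (RealRMK.integral_rieszMeasure Λ f).symm

theorem exists_invariant_measure [MulAction G X] [ContinuousConstSMul G X]
    (h : ∀ (F : Finset G) (Φ : Finset C_c(X, ℝ)) (ε : ℝ), 0 < ε →
      ∃ (I : Type w) (_ : Fintype I) (_ : Nonempty I) (y : I → X), ∀ s ∈ F, ∀ f ∈ Φ,
        |𝔼 i, f (s • y i) - 𝔼 i, f (y i)| ≤ ε) :
    ∃ μ : Measure X, IsProbabilityMeasure μ ∧ μ.Regular ∧
      ∀ g : G, μ.map (fun p => g • p) = μ := by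
  let J := Finset G × Finset C_c(X, ℝ) × ℕ
  have hJ : ∀ j : J, ∃ (I : Type w) (_ : Fintype I) (_ : Nonempty I) (y : I → X),
      ∀ s ∈ j.1, ∀ f ∈ j.2.1, |𝔼 i, f (s • y i) - 𝔼 i, f (y i)| ≤ 1 / ((j.2.2 : ℝ) + 1) :=
    fun j => h j.1 j.2.1 _ (by positivity)
  choose I _ _ y hy using hJ
  classical
  let U : Ultrafilter J := Ultrafilter.of atTop
  have hU : (U : Filter J) ≤ atTop := Ultrafilter.of_le _
  obtain ⟨Λ, hΛ⟩ := exists_tendsto_expect U y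
  refine ⟨RealRMK.rieszMeasure Λ, isProbabilityMeasure_rieszMeasure Λ fun f hf => ?_,
    inferInstance, fun g => map_smul_rieszMeasure Λ g fun f f' hf' => ?_⟩
  · exact tendsto_nhds_unique (hΛ f) (by simp [hf])
  · have hzero : Tendsto (fun j => 𝔼 i, f' (y j i) - 𝔼 i, f (y j i)) U (𝓝 0) := by
      have hindex : Tendsto (fun j : J => j.2.2) U atTop := tendsto_atTop.2 fun b => by
        filter_upwards [hU (mem_atTop ((∅, ∅, b) : J))] with j hj using hj.2.2
      refine squeeze_zero_norm' ?_ ((tendsto_one_div_add_atTop_nhds_zero_nat (𝕜 := ℝ)).comp hindex)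
      filter_upwards [hU (mem_atTop (({g}, {f}, 0) : J))] with j hj
      simpa only [hf', Real.norm_eq_abs, Function.comp_apply] using
        hy j g (hj.1 (by simp)) f (hj.2.1 (by simp))
    exact sub_eq_zero.1 (tendsto_nhds_unique ((hΛ f').sub (hΛ f)) hzero)

end InvariantMeasure

/-! ### Ramsey's theorem -/

section Ramsey

open Filter Finset

variable {I κ : Type*}

lemma exists_infinite_forall_lt_and_insert {r : ℕ}
    (ih : ∀ (S : Set ℕ), S.Infinite → ∀ c : Finset ℕ → κ, ∃ H ⊆ S, H.Infinite ∧
      ∃ k, ∀ s : Finset ℕ, (s : Set ℕ) ⊆ H → #s = r → c s = k)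
    (c : Finset ℕ → κ) {T : Set ℕ} (hT : T.Infinite) :
    ∃ a ∈ T, ∃ H ⊆ T, H.Infinite ∧ (∀ b ∈ H, a < b) ∧
      ∃ k, ∀ t : Finset ℕ, (t : Set ℕ) ⊆ H → #t = r → c (insert a t) = k := by
  obtain ⟨a, ha⟩ := hT.nonempty
  obtain ⟨H, hHT, hH, k, hk⟩ := ih (T \ Set.Iic a) (hT.sdiff (Set.finite_Iic a))
    fun t => c (insert a t)
  exact ⟨a, ha, H, fun b hb => (hHT hb).1, hH, fun b hb => not_le.1 (hHT hb).2, k, hk⟩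

theorem exists_infinite_homogeneous [Finite κ] (r : ℕ) (S : Set ℕ) (hS : S.Infinite)
    (c : Finset ℕ → κ) : ∃ H ⊆ S, H.Infinite ∧
      ∃ k, ∀ s : Finset ℕ, (s : Set ℕ) ⊆ H → #s = r → c s = k := by
  induction r generalizing S c with
  | zero => exact ⟨S, subset_rfl, hS, c ∅, fun s _ hs => by rw [card_eq_zero.1 hs]⟩
  | succ r ih =>
    have : Nonempty κ := ⟨c ∅⟩
    choose! a ha next hsub hinf hlt k hk using
      fun (T : Set ℕ) (hT : T.Infinite) => exists_infinite_forall_lt_and_insert ih c hT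
    let T : ℕ → Set ℕ := fun i => next^[i] S
    have hT : ∀ i, T (i + 1) = next (T i) := fun i => Function.iterate_succ_apply' _ _ _
    have hTinf : ∀ i, (T i).Infinite := fun i => by
      induction i with
      | zero => exact hS
      | succ i hi => exact hT i ▸ hinf _ hi
    have hanti : Antitone T :=
      antitone_nat_of_succ_le fun i => by rw [hT]; exact hsub _ (hTinf i)
    have hmono : StrictMono fun i => a (T i) := strictMono_nat_of_lt_succ fun i =>
      hlt (T i) (hTinf i) _ (by rw [← hT]; exact ha _ (hTinf (i + 1)))
    obtain ⟨κ₀, hκ⟩ := Finite.exists_infinite_fiber fun i => k (T i)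
    rw [Set.infinite_coe_iff] at hκ
    refine ⟨(fun i => a (T i)) '' ((fun i => k (T i)) ⁻¹' {κ₀}),
      Set.image_subset_iff.2 fun i _ => hanti (Nat.zero_le i) (ha _ (hTinf i)),
      hκ.image hmono.injective.injOn, κ₀, fun s hs hcard => ?_⟩
    have hne : s.Nonempty := card_pos.1 (by omega)
    obtain ⟨i, hi, hmin : a (T i) = s.min' hne⟩ := hs (s.min'_mem hne)
    rw [← insert_erase (s.min'_mem hne), ← hmin, ← show k (T i) = κ₀ from hi]
    refine hk (T i) (hTinf i) _ (fun b hb => ?_) ?_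
    · rw [coe_erase] at hb
      obtain ⟨j, -, rfl⟩ := hs hb.1
      have hij : a (T i) < a (T j) :=
        lt_of_le_of_ne (hmin ▸ s.min'_le _ hb.1) fun h => hb.2 h.symm
      rw [← hT]
      exact hanti (Nat.succ_le_of_lt (hmono.lt_iff_lt.1 hij)) (ha _ (hTinf j))
    · rw [hmin, card_erase_of_mem (s.min'_mem hne), hcard, Nat.add_sub_cancel]

/-- The rank of `p i` among the distinct values of `p`, counted from `0`. -/
def valueRank [Fintype I] (p : I → ℕ) (i : I) : ℕ :=
  #(({j | p j < p i} : Finset I).image p)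

lemma valueRank_lt_card [Fintype I] (p : I → ℕ) (i : I) : valueRank p i < Fintype.card I :=
  card_image_le.trans_lt (card_lt_univ_of_notMem (x := i) (by simp))

lemma valueRank_le_of_lt_iff [Fintype I] {p q : I → ℕ} (h : ∀ i j, p i < p j ↔ q i < q j) (i : I) :
    valueRank p i ≤ valueRank q i := by
  refine card_le_card_of_forall_subsingleton (fun m n => ∃ j, p j = m ∧ q j = n)
    (fun m hm => ?_) fun n _ => ?_
  · obtain ⟨j, hj, rfl⟩ := mem_image.1 hm
    exact ⟨q j, mem_image_of_mem q (by simpa [← h] using hj), j, rfl, rfl⟩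
  · rintro m ⟨-, j, rfl, rfl⟩ m' ⟨-, j', rfl, hj'⟩
    have := h j j'
    have := h j' j
    omega

lemma exists_strictMono_apply_valueRank [Fintype I] (p : I → ℕ) :
    ∃ s : ℕ → ℕ, StrictMono s ∧ ∀ i, s (valueRank p i) = p i := by
  classical
  let T : ℕ → Prop := fun n => (∃ i, p i = n) ∨ ∀ i, p i < n
  have hT : (Set.ofPred T).Infinite := Set.infinite_of_forall_exists_gt fun a =>
    ⟨a + univ.sup p + 1, Or.inr fun i => by have := le_sup (f := p) (mem_univ i); omega, by omega⟩
  refine ⟨Nat.nth T, Nat.nth_strictMono hT, fun i => ?_⟩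
  have hcount : valueRank p i = Nat.count T (p i) := by
    rw [Nat.count_eq_card_filter_range, valueRank]
    congr 1
    ext n
    simp only [mem_image, mem_filter, mem_univ, true_and, mem_range, T]
    constructor
    · rintro ⟨j, hj, rfl⟩
      exact ⟨hj, Or.inl ⟨j, rfl⟩⟩
    · rintro ⟨hn, ⟨j, rfl⟩ | hj⟩
      · exact ⟨j, hn, rfl⟩
      · exact absurd (hj i) hn.asymm
  rw [hcount, Nat.nth_count (Or.inl ⟨i, rfl⟩)]

/-- Ramsey's theorem for the colouring of the `|I|`-element sets by the family of the colours of all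
maps from `I` into the set. -/
theorem exists_strictMono_colour_eq [Finite I] [Finite κ] (c : (I → ℕ) → κ) :
    ∃ h : ℕ → ℕ, StrictMono h ∧ ∀ p q : I → ℕ, (∀ i j, p i < p j ↔ q i < q j) →
      c (h ∘ p) = c (h ∘ q) := by
  have := Fintype.ofFinite I
  let r := Fintype.card I
  let d : Finset ℕ → (I → Fin r) → κ := fun s f =>
    if hs : #s = r then c (s.orderEmbOfFin hs ∘ f) else c 0
  obtain ⟨H, -, hH, k, hk⟩ := exists_infinite_homogeneous r Set.univ Set.infinite_univ d
  have : Infinite H := hH.to_subtype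
  classical
  let h : ℕ ↪o ℕ := Nat.orderEmbeddingOfSet H
  have hcolour : ∀ (t : Fin r → ℕ) (f : I → Fin r), StrictMono t → c (h ∘ t ∘ f) = k f := by
    intro t f ht
    have hmono : StrictMono (h ∘ t) := h.strictMono.comp ht
    let s : Finset ℕ := univ.image (h ∘ t)
    have hs : #s = r := by
      rw [card_image_of_injective _ hmono.injective, card_univ, Fintype.card_fin]
    have hsH : (s : Set ℕ) ⊆ H := fun m hm => by
      obtain ⟨i, -, rfl⟩ := mem_image.1 hm
      exact Nat.orderEmbeddingOfSet_range H ▸ Set.mem_range_self (t i)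
    rw [← hk s hsH hs, show d s f = _ from dif_pos hs,
      ← orderEmbOfFin_unique hs (fun i => mem_image_of_mem _ (mem_univ i)) hmono]
    rfl
  let f : (I → ℕ) → I → Fin r := fun p i => ⟨valueRank p i, valueRank_lt_card p i⟩
  have hf : ∀ p, c (h ∘ p) = k (f p) := fun p => by
    obtain ⟨s, hs, hsp⟩ := exists_strictMono_apply_valueRank p
    rw [← hcolour (fun m => s m) (f p) fun m n hmn => hs hmn]
    exact congrArg c (funext fun i => congrArg h (hsp i).symm)
  refine ⟨h, h.strictMono, fun p q hpq => ?_⟩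
  rw [hf, hf, show f p = f q from funext fun i => Fin.ext <| le_antisymm
    (valueRank_le_of_lt_iff hpq i) (valueRank_le_of_lt_iff (fun i j => (hpq i j).symm) i)]

/-- By compactness: counterexamples for every `K` would have an ultralimit contradicting
`exists_strictMono_colour_eq`. -/
theorem exists_bound_strictMono_colour_eq (I κ : Type*) [Finite I] [Finite κ] (N : ℕ) :
    ∃ K : ℕ, ∀ c : (I → ℕ) → κ, ∃ h : ℕ → ℕ, StrictMono h ∧ (∀ i < N, h i < K) ∧
      ∀ p q : I → ℕ, (∀ i, p i < N) → (∀ i, q i < N) → (∀ i j, p i < p j ↔ q i < q j) →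
        c (h ∘ p) = c (h ∘ q) := by
  by_contra! hcon
  choose c hc using hcon
  let U : Ultrafilter ℕ := hyperfilter ℕ
  have hlim : ∀ p : I → ℕ, ∃ k : κ, ∀ᶠ K in (U : Filter ℕ), c K p = k := fun p => by
    obtain ⟨k, hk⟩ := Ultrafilter.eq_pure_of_finite (U.map fun K => c K p)
    have hmem : {k} ∈ U.map fun K => c K p := by rw [hk]; exact Set.mem_singleton k
    exact ⟨k, hmem⟩
  choose d hd using hlim
  obtain ⟨h, hmono, hh⟩ := exists_strictMono_colour_eq d
  have hagree : ∀ᶠ K in (U : Filter ℕ), ∀ p : I → Fin N,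
      c K (h ∘ fun i => (p i : ℕ)) = d (h ∘ fun i => (p i : ℕ)) :=
    eventually_all.2 fun p => hd _
  have hlarge : ∀ᶠ K in (U : Filter ℕ), h N ≤ K :=
    Nat.hyperfilter_le_atTop (eventually_ge_atTop (h N))
  obtain ⟨K, hcd, hK⟩ := (hagree.and hlarge).exists
  obtain ⟨p, q, hp, hq, hpq, hne⟩ := hc K h hmono fun i hi => (hmono hi).trans_le hK
  exact hne <| (hcd fun i => ⟨p i, hp i⟩).trans <|
    (hh p q hpq).trans (hcd fun i => ⟨q i, hq i⟩).symm

theorem exists_bound_strictMono_approx (I J : Type*) [Finite I] [Finite J] (N : ℕ) (C : ℝ) {ε : ℝ}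
    (hε : 0 < ε) :
    ∃ K : ℕ, ∀ c : (I → ℕ) → J → ℝ, (∀ p j, |c p j| ≤ C) →
      ∃ h : ℕ → ℕ, StrictMono h ∧ (∀ i < N, h i < K) ∧
        ∀ p q : I → ℕ, (∀ i, p i < N) → (∀ i, q i < N) → (∀ i j, p i < p j ↔ q i < q j) →
          ∀ j, |c (h ∘ p) j - c (h ∘ q) j| ≤ ε := by
  obtain ⟨K, hK⟩ := exists_bound_strictMono_colour_eq I (J → Set.Icc ⌊-C / ε⌋ ⌊C / ε⌋) N
  refine ⟨K, fun c hc => ?_⟩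
  let d : (I → ℕ) → J → Set.Icc ⌊-C / ε⌋ ⌊C / ε⌋ := fun p j =>
    ⟨⌊c p j / ε⌋, Int.floor_mono (by gcongr; exact (abs_le.1 (hc p j)).1),
      Int.floor_mono (by gcongr; exact (abs_le.1 (hc p j)).2)⟩
  obtain ⟨h, hmono, hlt, hh⟩ := hK d
  refine ⟨h, hmono, hlt, fun p q hp hq hpq j => ?_⟩
  have hfloor : ⌊c (h ∘ p) j / ε⌋ = ⌊c (h ∘ q) j / ε⌋ :=
    congrArg Subtype.val (congrFun (hh p q hp hq hpq) j)
  have hdiff := Int.abs_sub_lt_one_of_floor_eq_floor hfloor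
  rw [← sub_div, abs_div, abs_of_pos hε, div_lt_one hε] at hdiff
  exact hdiff.le

end Ramsey

/-! ### Tuples in relational structures -/

section Tuples

lemma append_comp_castAdd {α : Type*} {m n : ℕ} (s : Fin m → α) (t : Fin n → α) :
    Fin.append s t ∘ Fin.castAdd n = s :=
  funext (Fin.append_left s t)

lemma append_comp_natAdd {α : Type*} {m n : ℕ} (s : Fin m → α) (t : Fin n → α) :
    Fin.append s t ∘ Fin.natAdd m = t :=
  funext (Fin.append_right s t)

lemma append_comp_apply {α β : Type*} {m n : ℕ} (f : α → β) (s : Fin m → α) (t : Fin n → α) :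
    Fin.append (f ∘ s) (f ∘ t) = f ∘ Fin.append s t :=
  funext (Fin.addCases (fun i => by simp) fun i => by simp)

variable (L : FirstOrder.Language.{u, v})

lemma exists_fg_lift {M : Type w} [L.Structure M] {ι κ : Type*} [Finite ι] [Finite κ]
    (p : ι → κ → M) :
    ∃ S : L.Substructure M, S.FG ∧ ∃ p' : ι → κ → S, ∀ i, p i = S.subtype ∘ p' i := by
  have hfin : (Set.range fun z : ι × κ => p z.1 z.2).Finite := Set.finite_range _
  exact ⟨_, Substructure.fg_closure hfin,
    fun i j => ⟨p i j, Substructure.subset_closure ⟨(i, j), rfl⟩⟩, fun _ => rfl⟩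

variable {L} [L.IsRelational] {M : Type w} [L.Structure M]
  {ι : Type*} {a b : ι → M}

variable (L) in
/-- The structure induced on the index set of a tuple `a` by the relations that hold between the
entries of `a`. -/
abbrev tupleStructure (a : ι → M) : L.Structure ι where
  funMap f := isEmptyElim f
  RelMap R z := Structure.RelMap R (a ∘ z)

lemma exists_partialEquiv_of_relMap_iff (ha : Function.Injective a) (hb : Function.Injective b)
    (h : ∀ (m : ℕ) (R : L.Relations m) (z : Fin m → ι),
      Structure.RelMap R (a ∘ z) ↔ Structure.RelMap R (b ∘ z)) :
    ∃ f : M ≃ₚ[L] M, (f.dom : Set M) = Set.range a ∧ (f.cod : Set M) = Set.range b ∧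
      ∀ i (hi : a i ∈ f.dom), (f.toEquiv ⟨a i, hi⟩ : M) = b i := by
  let := tupleStructure L a
  let α : ι ↪[L] M := ⟨⟨a, ha⟩, fun f => isEmptyElim f, fun _ _ => Iff.rfl⟩
  let β : ι ↪[L] M := ⟨⟨b, hb⟩, fun f => isEmptyElim f, fun R z => (h _ R z).symm⟩
  refine ⟨⟨α.toHom.range, β.toHom.range, β.equivRange.comp α.equivRange.symm⟩, rfl, rfl,
    fun i _ => ?_⟩
  have hi : α.equivRange.symm (α.equivRange i) = i := α.equivRange.symm_apply_apply i
  exact (congrArg (fun j => (β.equivRange j : M)) hi :)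

theorem exists_aut_of_relMap_iff [Finite ι] (hu : L.IsUltrahomogeneous M)
    (ha : Function.Injective a) (hb : Function.Injective b)
    (h : ∀ (m : ℕ) (R : L.Relations m) (z : Fin m → ι),
      Structure.RelMap R (a ∘ z) ↔ Structure.RelMap R (b ∘ z)) :
    ∃ g : Aut L M, ∀ i, g (a i) = b i := by
  obtain ⟨f, hdom, -, hf⟩ := exists_partialEquiv_of_relMap_iff ha hb h
  have hfg : f.dom.FG := by
    rw [Substructure.fg_iff_structure_fg, Structure.fg_iff_finite]
    exact (hdom ▸ Set.finite_range a : (f.dom : Set M).Finite).to_subtype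
  obtain ⟨g, hg⟩ := hu f.dom hfg f.toEmbedding
  refine ⟨g, fun i => ?_⟩
  have hi : a i ∈ f.dom := hdom.ge ⟨i, rfl⟩
  rw [← hf i hi]
  exact (DFunLike.congr_fun hg ⟨a i, hi⟩).symm

end Tuples

/-! ### Structures with equivalence relations and orders on finite subsets -/

section Structures

variable {P : Set ℕ} {M : Type w} {N : Type x} [(langP P).Structure M] [(langP P).Structure N]

lemma relE_embedding (f : M ↪[langP P] N) (n : ℕ) (hn : 0 < n) (s t : Fin n → M) :
    relE P n hn (f ∘ s) (f ∘ t) ↔ relE P n hn s t := by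
  rw [relE, append_comp_apply]
  exact f.map_rel _ _

lemma relLt_embedding (f : M ↪[langP P] N) (n : ℕ) (hn : n ∈ P) (s t : Fin n → M) :
    relLt P n hn (f ∘ s) (f ∘ t) ↔ relLt P n hn s t := by
  rw [relLt, append_comp_apply]
  exact f.map_rel _ _

lemma relMap_comp_iff {ι : Type*} {a : ι → M} {b : ι → N}
    (hE : ∀ (n : ℕ) (hn : 0 < n) (s t : Fin n → ι),
      relE P n hn (a ∘ s) (a ∘ t) ↔ relE P n hn (b ∘ s) (b ∘ t))
    (hlt : ∀ (n : ℕ) (hn : n ∈ P) (s t : Fin n → ι),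
      relLt P n hn (a ∘ s) (a ∘ t) ↔ relLt P n hn (b ∘ s) (b ∘ t))
    (m : ℕ) (R : (langP P).Relations m) (z : Fin m → ι) :
    Structure.RelMap R (a ∘ z) ↔ Structure.RelMap R (b ∘ z) := by
  cases R with
  | E n hn =>
    rw [← Fin.append_castAdd_natAdd (f := z), ← append_comp_apply, ← append_comp_apply]
    exact hE n hn _ _
  | lt n hn =>
    rw [← Fin.append_castAdd_natAdd (f := z), ← append_comp_apply, ← append_comp_apply]
    exact hlt n hn _ _

lemma isEquivOnSubsets_of_forall_fg {n : ℕ} {hn : 0 < n}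
    (h : ∀ S : (langP P).Substructure M, S.FG → IsEquivOnSubsets (relE P (C := S) n hn)) :
    IsEquivOnSubsets (relE P (C := M) n hn) := by
  refine ⟨fun s t => ?_, fun s => ?_, fun s t => ?_, fun s t r => ?_⟩
  · obtain ⟨S, hS, p, hp⟩ := exists_fg_lift (langP P) ![s, t]
    obtain ⟨rfl, rfl⟩ : s = _ ∧ t = _ := ⟨hp 0, hp 1⟩
    rw [relE_embedding]
    exact fun hst => ((h S hS).inj _ _ hst).imp Subtype.val_injective.comp
      Subtype.val_injective.comp
  · obtain ⟨S, hS, p, hp⟩ := exists_fg_lift (langP P) ![s]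
    obtain rfl : s = _ := hp 0
    intro hs σ
    rw [Function.comp_assoc, relE_embedding]
    exact (h S hS).perm _ hs.of_comp σ
  · obtain ⟨S, hS, p, hp⟩ := exists_fg_lift (langP P) ![s, t]
    obtain ⟨rfl, rfl⟩ : s = _ ∧ t = _ := ⟨hp 0, hp 1⟩
    simp only [relE_embedding]
    exact (h S hS).symm _ _
  · obtain ⟨S, hS, p, hp⟩ := exists_fg_lift (langP P) ![s, t, r]
    obtain ⟨rfl, rfl, rfl⟩ : s = _ ∧ t = _ ∧ r = _ := ⟨hp 0, hp 1, hp 2⟩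
    simp only [relE_embedding]
    exact (h S hS).trans _ _ _

lemma isLinearOrderOnClasses_of_forall_fg {n : ℕ} {hn : 0 < n} {hnP : n ∈ P}
    (h : ∀ S : (langP P).Substructure M, S.FG →
      IsLinearOrderOnClasses (relE P (C := S) n hn) (relLt P n hnP)) :
    IsLinearOrderOnClasses (relE P (C := M) n hn) (relLt P n hnP) := by
  refine ⟨fun s t => ?_, fun s t p q => ?_, fun s t => ?_, fun s t r => ?_, fun s t => ?_⟩
  · obtain ⟨S, hS, p, hp⟩ := exists_fg_lift (langP P) ![s, t]
    obtain ⟨rfl, rfl⟩ : s = _ ∧ t = _ := ⟨hp 0, hp 1⟩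
    rw [relLt_embedding]
    exact fun hst => ((h S hS).inj _ _ hst).imp Subtype.val_injective.comp
      Subtype.val_injective.comp
  · obtain ⟨S, hS, z, hz⟩ := exists_fg_lift (langP P) ![s, t, p, q]
    obtain ⟨rfl, rfl, rfl, rfl⟩ : s = _ ∧ t = _ ∧ p = _ ∧ q = _ := ⟨hz 0, hz 1, hz 2, hz 3⟩
    simp only [relE_embedding, relLt_embedding]
    exact (h S hS).respects _ _ _ _
  · obtain ⟨S, hS, p, hp⟩ := exists_fg_lift (langP P) ![s, t]
    obtain ⟨rfl, rfl⟩ : s = _ ∧ t = _ := ⟨hp 0, hp 1⟩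
    simp only [relE_embedding, relLt_embedding]
    exact (h S hS).irrefl _ _
  · obtain ⟨S, hS, p, hp⟩ := exists_fg_lift (langP P) ![s, t, r]
    obtain ⟨rfl, rfl, rfl⟩ : s = _ ∧ t = _ ∧ r = _ := ⟨hp 0, hp 1, hp 2⟩
    simp only [relLt_embedding]
    exact (h S hS).trans _ _ _
  · obtain ⟨S, hS, p, hp⟩ := exists_fg_lift (langP P) ![s, t]
    obtain ⟨rfl, rfl⟩ : s = _ ∧ t = _ := ⟨hp 0, hp 1⟩
    simp only [relE_embedding, relLt_embedding]
    exact fun hs ht => (h S hS).total _ _ hs.of_comp ht.of_comp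

variable (P M) in
/-- A structure of any cardinality satisfying the axioms of the class `classK`. -/
structure IsKStructure : Prop where
  pos : ∀ n ∈ P, 0 < n
  equiv : ∀ (n : ℕ) (hn : 0 < n), IsEquivOnSubsets (relE P (C := M) n hn)
  linearOrder : ∀ (n : ℕ) (hn : n ∈ P),
    IsLinearOrderOnClasses (relE P (C := M) n (pos n hn)) (relLt P (C := M) n hn)

namespace IsKStructure

lemma of_mem_classK {hP : ∀ n ∈ P, 3 ≤ n} {C : CategoryTheory.Bundled.{w} (langP P).Structure}
    (hC : C ∈ classK P hP) : IsKStructure P C :=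
  ⟨_, hC.2.1, hC.2.2⟩

lemma mem_classK (hP : ∀ n ∈ P, 3 ≤ n) [Finite M] (hM : IsKStructure P M) :
    (⟨M, inferInstance⟩ : CategoryTheory.Bundled.{w} (langP P).Structure) ∈ classK P hP :=
  ⟨inferInstance, hM.equiv, hM.linearOrder⟩

lemma comap (hN : IsKStructure P N) (f : M ↪[langP P] N) : IsKStructure P M where
  pos := hN.pos
  equiv n hn := by
    have h := hN.equiv n hn
    refine ⟨fun s t hst => ?_, fun s hs σ => ?_, fun s t => ?_, fun s t r => ?_⟩
    · have := h.inj _ _ ((relE_embedding f n hn s t).2 hst)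
      exact ⟨this.1.of_comp, this.2.of_comp⟩
    · exact (relE_embedding f n hn s (s ∘ σ)).1 (h.perm _ (f.injective.comp hs) σ)
    · simp only [← relE_embedding f]
      exact h.symm _ _
    · simp only [← relE_embedding f]
      exact h.trans _ _ _
  linearOrder n hn := by
    have h := hN.linearOrder n hn
    refine ⟨fun s t hst => ?_, fun s t p q => ?_, fun s t => ?_, fun s t r => ?_,
      fun s t hs ht => ?_⟩
    · have := h.inj _ _ ((relLt_embedding f n hn s t).2 hst)
      exact ⟨this.1.of_comp, this.2.of_comp⟩
    · simp only [← relE_embedding f, ← relLt_embedding f]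
      exact h.respects _ _ _ _
    · simp only [← relE_embedding f, ← relLt_embedding f]
      exact h.irrefl _ _
    · simp only [← relLt_embedding f]
      exact h.trans _ _ _
    · simp only [← relE_embedding f, ← relLt_embedding f]
      exact h.total _ _ (f.injective.comp hs) (f.injective.comp ht)

lemma not_relLt_self (hM : IsKStructure P M) {n : ℕ} (hn : n ∈ P) (s : Fin n → M) :
    ¬ relLt P n hn s s := fun h =>
  (hM.linearOrder n hn).irrefl s s h
    ((hM.equiv n (hM.pos n hn)).perm s ((hM.linearOrder n hn).inj s s h).1 1)

end IsKStructure

lemma isKStructure_of_isFraisseLimit {hP : ∀ n ∈ P, 3 ≤ n} [Countable M]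
    (hM : IsFraisseLimit (classK.{w} P hP) M) : IsKStructure P M := by
  have hfg : ∀ S : (langP P).Substructure M, S.FG → IsKStructure P S := fun S hS =>
    .of_mem_classK (hP := hP) (C := ⟨S, inferInstance⟩) (hM.age ▸ age.fg_substructure hS)
  exact ⟨fun n hn => three_pos.trans_le (hP n hn),
    fun n hn => isEquivOnSubsets_of_forall_fg fun S hS => (hfg S hS).equiv n hn,
    fun n hn => isLinearOrderOnClasses_of_forall_fg fun S hS => (hfg S hS).linearOrder n hn⟩

end Structures

/-! ### Structures coded by labels of subsets -/

section Labels

variable {P : Set ℕ} {M : Type w} [(langP P).Structure M] {A B : Type*} {κ κ' : Type*}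
  [LinearOrder κ] [LinearOrder κ']

variable (P) in
/-- The tuple `v` is injective, and the relations between its entries are read off from a label
attached to each set of indices: subsets of the same size are equivalent if they have the same
label, and they are ordered in the same way as their labels. Finite members of the class are coded
in this form. -/
structure IsLabelledBy (v : A → M) (lab : Set A → κ) : Prop where
  injective : Function.Injective v
  relE_iff : ∀ (n : ℕ) (hn : 0 < n) (s t : Fin n → A), relE P n hn (v ∘ s) (v ∘ t) ↔
    Function.Injective s ∧ Function.Injective t ∧ lab (Set.range s) = lab (Set.range t)
  relLt_iff : ∀ (n : ℕ) (hn : n ∈ P) (s t : Fin n → A), relLt P n hn (v ∘ s) (v ∘ t) ↔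
    Function.Injective s ∧ Function.Injective t ∧ lab (Set.range s) < lab (Set.range t)

variable (P) in
/-- The two labellings code the same structure on `A`. -/
structure LabelSimilar (lab : Set A → κ) (lab' : Set A → κ') : Prop where
  eq_iff : ∀ S T : Set A, S.ncard = T.ncard → (lab S = lab T ↔ lab' S = lab' T)
  lt_iff : ∀ S T : Set A, S.ncard ∈ P → S.ncard = T.ncard → (lab S < lab T ↔ lab' S < lab' T)

lemma exists_injective_range_eq [Finite A] (S : Set A) :
    ∃ s : Fin S.ncard → A, Function.Injective s ∧ Set.range s = S :=
  ⟨fun i => (Finite.equivFinOfCardEq (Nat.card_coe_set_eq S)).symm i,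
    Subtype.val_injective.comp (Equiv.injective _), by
    rw [← Function.comp_def, EquivLike.range_comp, Subtype.range_coe]⟩

lemma ncard_range_fin {n : ℕ} {s : Fin n → A} (hs : Function.Injective s) :
    (Set.range s).ncard = n :=
  (Set.ncard_range_of_injective hs).trans (Nat.card_fin n)

namespace IsLabelledBy

variable {v : A → M} {lab : Set A → κ}

lemma comp (h : IsLabelledBy P v lab) {α : B → A} (hα : Function.Injective α) :
    IsLabelledBy P (v ∘ α) fun S => lab (α '' S) where
  injective := h.injective.comp hα
  relE_iff n hn s t := by
    simp only [Function.comp_assoc, h.relE_iff, hα.of_comp_iff, Set.range_comp]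
  relLt_iff n hn s t := by
    simp only [Function.comp_assoc, h.relLt_iff, hα.of_comp_iff, Set.range_comp]

lemma map {N : Type x} [(langP P).Structure N] (h : IsLabelledBy P v lab) (f : M ↪[langP P] N) :
    IsLabelledBy P (f ∘ v) lab where
  injective := f.injective.comp h.injective
  relE_iff n hn s t := by simp only [Function.comp_assoc, relE_embedding, h.relE_iff]
  relLt_iff n hn s t := by simp only [Function.comp_assoc, relLt_embedding, h.relLt_iff]

lemma labelSimilar [Finite A] {lab' : Set A → κ'} (h : IsLabelledBy P v lab)
    (h' : IsLabelledBy P v lab') : LabelSimilar P lab lab' where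
  eq_iff S T hST := by
    obtain ⟨s, hs, hsS⟩ := exists_injective_range_eq S
    obtain ⟨t, ht, htT⟩ := hST ▸ exists_injective_range_eq T
    rcases S.ncard.eq_zero_or_pos with h0 | hn
    · rw [S.ncard_eq_zero.1 h0, T.ncard_eq_zero.1 (hST ▸ h0)]
      exact iff_of_true rfl rfl
    · simpa only [hs, ht, true_and, hsS, htT] using
        (h.relE_iff _ hn s t).symm.trans (h'.relE_iff _ hn s t)
  lt_iff S T hn hST := by
    obtain ⟨s, hs, hsS⟩ := exists_injective_range_eq S
    obtain ⟨t, ht, htT⟩ := hST ▸ exists_injective_range_eq T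
    simpa only [hs, ht, true_and, hsS, htT] using
      (h.relLt_iff _ hn s t).symm.trans (h'.relLt_iff _ hn s t)

lemma relMap_iff {N : Type x} [(langP P).Structure N] {v' : A → N} {lab' : Set A → κ'}
    (h : IsLabelledBy P v lab) (h' : IsLabelledBy P v' lab') (hsim : LabelSimilar P lab lab')
    (m : ℕ) (R : (langP P).Relations m) (z : Fin m → A) :
    Structure.RelMap R (v ∘ z) ↔ Structure.RelMap R (v' ∘ z) := by
  refine relMap_comp_iff (fun n hn s t => ?_) (fun n hn s t => ?_) m R z
  · rw [h.relE_iff, h'.relE_iff]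
    exact and_congr_right fun hs => and_congr_right fun ht =>
      hsim.eq_iff _ _ ((ncard_range_fin hs).trans (ncard_range_fin ht).symm)
  · rw [h.relLt_iff, h'.relLt_iff]
    exact and_congr_right fun hs => and_congr_right fun ht =>
      hsim.lt_iff _ _ ((ncard_range_fin hs).symm ▸ hn)
        ((ncard_range_fin hs).trans (ncard_range_fin ht).symm)

lemma exists_aut [Finite A] (hu : (langP P).IsUltrahomogeneous M) {v' : A → M}
    {lab' : Set A → κ'} (h : IsLabelledBy P v lab) (h' : IsLabelledBy P v' lab')
    (hsim : LabelSimilar P lab lab') : ∃ g : Aut (langP P) M, ∀ a, g (v a) = v' a :=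
  exists_aut_of_relMap_iff hu h.injective h'.injective (h.relMap_iff h' hsim)

end IsLabelledBy

variable (P) in
/-- The structure on `A` coded by a labelling. -/
abbrev labelledStructure (lab : Set A → κ) : (langP P).Structure A where
  funMap f := f.elim
  RelMap
    | .E n _, z => Function.Injective (z ∘ Fin.castAdd n) ∧ Function.Injective (z ∘ Fin.natAdd n) ∧
        lab (Set.range (z ∘ Fin.castAdd n)) = lab (Set.range (z ∘ Fin.natAdd n))
    | .lt n _, z => Function.Injective (z ∘ Fin.castAdd n) ∧ Function.Injective (z ∘ Fin.natAdd n) ∧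
        lab (Set.range (z ∘ Fin.castAdd n)) < lab (Set.range (z ∘ Fin.natAdd n))

lemma isLabelledBy_id (lab : Set A → κ) :
    let := labelledStructure P lab
    IsLabelledBy P id lab := by
  let := labelledStructure P lab
  refine ⟨Function.injective_id, fun n hn s t => ?_, fun n hn s t => ?_⟩
  · simp only [relE, Structure.RelMap, Function.id_comp, append_comp_castAdd, append_comp_natAdd]
  · simp only [relLt, Structure.RelMap, Function.id_comp, append_comp_castAdd, append_comp_natAdd]

lemma isKStructure_of_isLabelledBy_id (hpos : ∀ n ∈ P, 0 < n) {lab : Set M → κ}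
    (h : IsLabelledBy P id lab) : IsKStructure P M := by
  have hE := h.relE_iff
  have hlt := h.relLt_iff
  simp only [Function.id_comp] at hE hlt
  refine ⟨hpos, fun n hn => ⟨fun s t => ?_, fun s hs σ => ?_, fun s t => ?_, fun s t r => ?_⟩,
    fun n hn => ⟨fun s t => ?_, fun s t p q => ?_, fun s t => ?_, fun s t r => ?_,
      fun s t hs ht => ?_⟩⟩ <;> simp only [hE, hlt]
  · exact fun h => ⟨h.1, h.2.1⟩
  · exact ⟨hs, hs.comp σ.injective, congrArg lab (σ.surjective.range_comp s).symm⟩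
  · exact fun h => ⟨h.2.1, h.1, h.2.2.symm⟩
  · exact fun h h' => ⟨h.1, h'.2.1, h.2.2.trans h'.2.2⟩
  · exact fun h => ⟨h.1, h.2.1⟩
  · exact fun hst hpq hlt => ⟨hst.2.1, hpq.2.1, hst.2.2 ▸ hpq.2.2 ▸ hlt.2.2⟩
  · exact fun hlt hE => hlt.2.2.ne hE.2.2
  · exact fun h h' => ⟨h.1, h'.2.1, h.2.2.trans h'.2.2⟩
  · exact fun hne => (lt_or_gt_of_ne fun he => hne ⟨hs, ht, he⟩).imp (⟨hs, ht, ·⟩) (⟨ht, hs, ·⟩)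

theorem exists_isLabelledBy {hP : ∀ n ∈ P, 3 ≤ n} [Countable M]
    (hM : IsFraisseLimit (classK.{w} P hP) M) [Finite A] (lab : Set A → κ) :
    ∃ v : A → M, IsLabelledBy P v lab := by
  obtain ⟨k, ⟨f⟩⟩ := Finite.exists_equiv_fin A
  let j : A ≃ ULift.{w} (Fin k) := f.trans Equiv.ulift.symm
  let lab' : Set (ULift.{w} (Fin k)) → κ := fun S => lab (j ⁻¹' S)
  let := labelledStructure P lab'
  have hlab' : IsLabelledBy P id lab' := isLabelledBy_id lab'
  have hmem := (isKStructure_of_isLabelledBy_id (isKStructure_of_isFraisseLimit hM).pos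
    hlab').mem_classK hP
  rw [← hM.age] at hmem
  obtain ⟨-, ⟨e⟩⟩ := hmem
  have hj := (hlab'.map e).comp j.injective
  simp only [lab', j.injective.preimage_image] at hj
  exact ⟨_, hj⟩

end Labels

/-! ### Labellings of finite structures -/

namespace IsEquivOnSubsets

variable {C : Type*} {n : ℕ} {R lt : (Fin n → C) → (Fin n → C) → Prop}

lemma of_range_eq (hR : IsEquivOnSubsets R) {s t : Fin n → C} (hs : Function.Injective s)
    (ht : Function.Injective t) (h : Set.range s = Set.range t) : R s t := by
  let σ : Equiv.Perm (Fin n) := ((Equiv.ofInjective t ht).trans (Equiv.setCongr h.symm)).trans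
    (Equiv.ofInjective s hs).symm
  have hσ : t = s ∘ σ := funext fun i => congrArg Subtype.val
    ((Equiv.ofInjective s hs).apply_symm_apply ⟨t i, h ▸ ⟨i, rfl⟩⟩).symm
  exact hσ ▸ hR.perm s hs σ

lemma exists_comp_range (hR : IsEquivOnSubsets R) {l : (Fin n → C) → ℕ}
    (hl : ∀ s t, R s t → l s = l t) :
    ∃ l' : Set C → ℕ, ∀ s, Function.Injective s → l' (Set.range s) = l s := by
  have hfac : Function.FactorsThrough (fun s : {s : Fin n → C // Function.Injective s} => l s)
      fun s => Set.range s.1 := fun s t hst => hl _ _ (hR.of_range_eq s.2 t.2 hst)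
  obtain ⟨l', hl'⟩ := (Function.factorsThrough_iff _).1 hfac
  exact ⟨l', fun s hs => (congrFun hl' ⟨s, hs⟩).symm⟩

lemma exists_label [Finite C] (hR : IsEquivOnSubsets R) :
    ∃ l : Set C → ℕ, ∀ s t, Function.Injective s → Function.Injective t →
      (R s t ↔ l (Set.range s) = l (Set.range t)) := by
  obtain ⟨q, hq⟩ := exists_injective_nat (Set (Fin n → C))
  have hl : ∀ s t, R s t → q {r | R s r} = q {r | R t r} := fun s t hst =>
    congrArg q (Set.ext fun r => ⟨hR.trans _ _ _ (hR.symm _ _ hst), hR.trans _ _ _ hst⟩)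
  obtain ⟨l, hl'⟩ := hR.exists_comp_range hl
  refine ⟨l, fun s t hs ht => ?_⟩
  rw [hl' s hs, hl' t ht]
  exact ⟨hl s t, fun h => (hq h).ge (hR.perm t ht 1)⟩

/-- The label of a tuple is the number of tuples below it. -/
lemma exists_orderLabel [Finite C] (hR : IsEquivOnSubsets R) (hlt : IsLinearOrderOnClasses R lt) :
    ∃ l : Set C → ℕ, ∀ s t, Function.Injective s → Function.Injective t →
      (R s t ↔ l (Set.range s) = l (Set.range t)) ∧
        (lt s t ↔ l (Set.range s) < l (Set.range t)) := by
  have hE : ∀ s t, R s t → {r | lt r s}.ncard = {r | lt r t}.ncard := fun s t hst =>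
    congrArg Set.ncard (Set.ext fun r =>
      ⟨fun h => hlt.respects _ _ _ _ (hR.perm r (hlt.inj _ _ h).1 1) hst h,
        fun h => hlt.respects _ _ _ _ (hR.perm r (hlt.inj _ _ h).1 1) (hR.symm _ _ hst) h⟩)
  have hlt' : ∀ s t, lt s t → {r | lt r s}.ncard < {r | lt r t}.ncard := fun s t hst =>
    Set.ncard_lt_ncard ((Set.ssubset_iff_of_subset fun r hr => hlt.trans _ _ _ hr hst).2
      ⟨s, hst, fun h => hlt.irrefl _ _ h (hR.perm s (hlt.inj _ _ h).1 1)⟩)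
  obtain ⟨l, hl⟩ := hR.exists_comp_range hE
  refine ⟨l, fun s t hs ht => ?_⟩
  have htri : R s t ∨ lt s t ∨ lt t s := or_iff_not_imp_left.2 (hlt.total s t hs ht)
  rw [hl s hs, hl t ht]
  refine ⟨⟨hE s t, fun h => ?_⟩, hlt' s t, fun h => ?_⟩
  · exact htri.resolve_right fun h' => h'.elim (fun h' => (hlt' _ _ h').ne h)
      fun h' => (hlt' _ _ h').ne' h
  · exact (htri.resolve_left fun h' => h.ne (hE _ _ h')).resolve_right
      fun h' => (hlt' _ _ h').not_gt h

end IsEquivOnSubsets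

section FiniteStructures

variable {P : Set ℕ} {M : Type w} [(langP P).Structure M]

lemma IsKStructure.exists_isLabelledBy_id [Finite M] (hM : IsKStructure P M) :
    ∃ lab : Set M → ℕ, IsLabelledBy P id lab := by
  have h : ∀ n, ∃ l : Set M → ℕ, ∀ s t : Fin n → M, Function.Injective s →
      Function.Injective t → (∀ hn : 0 < n, relE P n hn s t ↔ l (Set.range s) = l (Set.range t)) ∧
        ∀ hn : n ∈ P, relLt P n hn s t ↔ l (Set.range s) < l (Set.range t) := fun n => by
    by_cases hn : n ∈ P
    · obtain ⟨l, hl⟩ := (hM.equiv n (hM.pos n hn)).exists_orderLabel (hM.linearOrder n hn)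
      exact ⟨l, fun s t hs ht => ⟨fun _ => (hl s t hs ht).1, fun _ => (hl s t hs ht).2⟩⟩
    · rcases n.eq_zero_or_pos with rfl | hn'
      · exact ⟨0, fun s t _ _ => ⟨fun h => absurd h (lt_irrefl 0), fun h => absurd h hn⟩⟩
      · obtain ⟨l, hl⟩ := (hM.equiv n hn').exists_label
        exact ⟨l, fun s t hs ht => ⟨fun _ => hl s t hs ht, fun h => absurd h hn⟩⟩
  choose l hl using h
  refine ⟨fun S => l S.ncard S, Function.injective_id, fun n hn s t => ⟨fun h => ?_, ?_⟩,
    fun n hn s t => ⟨fun h => ?_, ?_⟩⟩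
  · obtain ⟨hs, ht⟩ := (hM.equiv n hn).inj s t h
    simp only [ncard_range_fin hs, ncard_range_fin ht]
    exact ⟨hs, ht, ((hl n s t hs ht).1 hn).1 h⟩
  · rintro ⟨hs, ht, h⟩
    simp only [ncard_range_fin hs, ncard_range_fin ht] at h
    exact ((hl n s t hs ht).1 hn).2 h
  · obtain ⟨hs, ht⟩ := (hM.linearOrder n hn).inj s t h
    simp only [ncard_range_fin hs, ncard_range_fin ht]
    exact ⟨hs, ht, ((hl n s t hs ht).2 hn).1 h⟩
  · rintro ⟨hs, ht, h⟩
    simp only [ncard_range_fin hs, ncard_range_fin ht] at h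
    exact ((hl n s t hs ht).2 hn).2 h

lemma IsKStructure.exists_isLabelledBy {A : Type*} [Finite A] (hM : IsKStructure P M) {v : A → M}
    (hv : Function.Injective v) : ∃ (k : ℕ) (lab : Set A → Fin k), IsLabelledBy P v lab := by
  let := tupleStructure (langP P) v
  let e : A ↪[langP P] M := ⟨⟨v, hv⟩, fun f => f.elim, fun _ _ => Iff.rfl⟩
  obtain ⟨lab, hlab⟩ := (hM.comap e).exists_isLabelledBy_id
  obtain ⟨k, hk⟩ := (Set.finite_range lab).bddAbove
  have h : IsLabelledBy P v lab := hlab.map e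
  exact ⟨k + 1, fun S => ⟨lab S, Nat.lt_succ_of_le (hk ⟨S, rfl⟩)⟩, h.injective,
    fun n hn s t => by simpa only [Fin.mk_eq_mk] using h.relE_iff n hn s t,
    fun n hn s t => by simpa only [Fin.mk_lt_mk] using h.relLt_iff n hn s t⟩

end FiniteStructures

/-! ### Failure of Hrushovski's extension property -/

section Hrushovski

variable {P : Set ℕ} {M : Type w} [(langP P).Structure M]

lemma IsKStructure.not_relLt_comp [Finite M] (hM : IsKStructure P M) {n : ℕ} (hn : n ∈ P)
    (g : Aut (langP P) M) (s : Fin n → M) : ¬ relLt P n hn s (g ∘ s) := fun h => by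
  have : Finite (Aut (langP P) M) := DFunLike.finite _
  have hpow : ∀ i : ℕ, relLt P n hn s (⇑(g ^ (i + 1)) ∘ s) := fun i => by
    induction i with
    | zero => simpa only [zero_add, pow_one] using h
    | succ i ih =>
      rw [pow_succ' g (i + 1)]
      exact (hM.linearOrder n hn).trans _ _ _ h ((relLt_embedding g.toEmbedding n hn s _).2 ih)
  obtain ⟨k, hk, hgk⟩ := (isOfFinOrder_of_finite g).exists_pow_eq_one
  obtain ⟨i, rfl⟩ := Nat.exists_eq_succ_of_ne_zero hk.ne'
  have hs := hpow i
  rw [← Nat.succ_eq_add_one, hgk] at hs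
  exact hM.not_relLt_self hn s hs

/-- The label of a subset of two disjoint `n`-element sets, marking the first of the two. -/
noncomputable def leftLabel (n : ℕ) (S : Set (Fin n ⊕ Fin n)) : Fin 2 :=
  open Classical in if S = Set.range Sum.inl then 0 else 1

lemma leftLabel_inr_image {n : ℕ} (hn : 0 < n) (S : Set (Fin n)) :
    leftLabel n (Sum.inr '' S) = 1 := by
  refine if_neg fun h => ?_
  obtain ⟨i, -, hi⟩ : Sum.inl ⟨0, hn⟩ ∈ Sum.inr '' S := h ▸ Set.mem_range_self _
  exact Sum.inr_ne_inl hi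

lemma leftLabel_inl_image_eq_of_ncard_eq {n : ℕ} {S T : Set (Fin n)} (h : S.ncard = T.ncard) :
    leftLabel n (Sum.inl '' S) = leftLabel n (Sum.inl '' T) := by
  have key : ∀ S : Set (Fin n), Sum.inl '' S = Set.range (Sum.inl : Fin n → Fin n ⊕ Fin n) ↔
      S.ncard = n := fun S => by
    rw [← Set.image_univ, Sum.inl_injective.image_injective.eq_iff, Set.eq_univ_iff_ncard,
      Nat.card_fin]
  simp only [leftLabel, key, h]

lemma labelSimilar_leftLabel {P : Set ℕ} {n : ℕ} (hn : 0 < n) :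
    LabelSimilar P (fun S => leftLabel n (Sum.inl '' S)) fun S => leftLabel n (Sum.inr '' S) where
  eq_iff S T h := by
    simp only [leftLabel_inr_image hn, leftLabel_inl_image_eq_of_ncard_eq h]
  lt_iff S T _ h := by
    simp only [leftLabel_inr_image hn, leftLabel_inl_image_eq_of_ncard_eq h, lt_irrefl]

theorem not_hrushovskiExtension {hP : ∀ n ∈ P, 3 ≤ n} [Countable M] (hne : P.Nonempty)
    (hM : IsFraisseLimit (classK.{w} P hP) M) : ¬ HrushovskiExtension (langP P) M := by
  intro hH
  have hK := isKStructure_of_isFraisseLimit hM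
  obtain ⟨n, hn⟩ := hne
  have hn' := hK.pos n hn
  obtain ⟨v, hv⟩ := exists_isLabelledBy hM (leftLabel n)
  have hl := hv.comp Sum.inl_injective
  have hr := hv.comp Sum.inr_injective
  obtain ⟨f, hdom, -, hf⟩ := exists_partialEquiv_of_relMap_iff hl.injective hr.injective
    (hl.relMap_iff hr (labelSimilar_leftLabel hn'))
  have hi : ∀ i, v (Sum.inl i) ∈ f.dom := fun i => hdom.ge ⟨i, rfl⟩
  obtain ⟨F, _, hF⟩ := hH 1 (fun _ => f) fun _ =>
    (hdom ▸ Set.finite_range _ : (f.dom : Set M).Finite).to_subtype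
  obtain ⟨hdomF, -, g, hg⟩ := hF 0
  let s : Fin n → F := fun i => ⟨v (Sum.inl i), hdomF (hi i)⟩
  have hgs : F.subtype ∘ g ∘ s = v ∘ Sum.inr := funext fun i => (hg _ (hi i)).trans (hf i (hi i))
  refine (hK.comap F.subtype).not_relLt_comp hn g s ?_
  rw [← relLt_embedding F.subtype, hgs]
  refine (hv.relLt_iff n hn Sum.inl Sum.inr).2 ⟨Sum.inl_injective, Sum.inr_injective, ?_⟩
  rw [← Set.image_univ, ← Set.image_univ, leftLabel_inr_image hn', Set.image_univ, leftLabel,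
    if_pos rfl]
  exact Fin.zero_lt_one

end Hrushovski

/-! ### Open subgroups of extremely amenable groups -/

section ExtremelyAmenable

variable {G : Type w} [Group G]

lemma IsExtremelyAmenable.exists_forall_smul_eq [TopologicalSpace G]
    (hG : IsExtremelyAmenable.{w, x} G) (X : Type*) [Small.{x} X] [TopologicalSpace X]
    [CompactSpace X] [T2Space X] [Nonempty X] [MulAction G X] [ContinuousSMul G X] :
    ∃ p : X, ∀ g : G, g • p = p := by
  let e := Shrink.homeomorph.{x} X
  have hsmul : ∀ (g : G) (p : Shrink.{x} X), e.symm (g • p) = g • e.symm p := fun g p =>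
    (equivShrink X).symm_apply_apply _
  have := e.compactSpace
  have := e.t2Space
  have : ContinuousSMul G (Shrink.{x} X) :=
    e.symm.isInducing.continuousSMul continuous_id (hsmul _ _)
  have : Nonempty (Shrink.{x} X) := e.symm.surjective.nonempty
  obtain ⟨p, hp⟩ := hG (Shrink.{x} X)
  exact ⟨e.symm p, fun g => by rw [← hsmul, hp]⟩

section Tournament

variable {Q : Type*} [MulAction G Q]

attribute [local instance] arrowAction

lemma continuousSMul_arrow [TopologicalSpace G] [ContinuousInv G] [TopologicalSpace Q]
    [DiscreteTopology Q] [ContinuousSMul G Q] (Y : Type*) [TopologicalSpace Y] :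
    ContinuousSMul G (Q → Y) := by
  refine ⟨continuous_pi fun q => ?_⟩
  have heval : Continuous fun z : Q × (Q → Y) => z.2 z.1 :=
    continuous_prod_of_discrete_left.2 continuous_apply
  exact heval.comp (f := fun z : G × (Q → Y) => (z.1⁻¹ • q, z.2)) (by fun_prop)

variable (G Q) in
/-- The `G`-invariant space of all tournaments on `Q`: of any two distinct points exactly one
dominates the other. -/
def tournaments : SubMulAction G (Q × Q → Bool) where
  carrier := {R | ∀ p q, p ≠ q → R (p, q) = !R (q, p)}
  smul_mem' g _ hR p q hpq := hR (g⁻¹ • p) (g⁻¹ • q) ((MulAction.injective g⁻¹).ne hpq)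

lemma isClosed_tournaments : IsClosed (tournaments G Q : Set (Q × Q → Bool)) := by
  have h : (tournaments G Q : Set (Q × Q → Bool)) =
      ⋂ (p) (q) (_ : p ≠ q), {R | R (p, q) = !R (q, p)} := by
    ext R
    simp only [Set.mem_iInter]
    rfl
  rw [h]
  exact isClosed_iInter fun p => isClosed_iInter fun q => isClosed_iInter fun _ =>
    isClosed_eq (continuous_apply _) <|
      (continuous_of_discreteTopology (f := Bool.not)).comp (continuous_apply _)

lemma nonempty_tournaments : Nonempty (tournaments G Q) := by
  classical
  let : LinearOrder Q := linearOrderOfSTO WellOrderingRel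
  refine ⟨⟨fun z => decide (z.1 < z.2), fun p q hpq => ?_⟩⟩
  rw [← decide_not, decide_eq_decide, not_lt]
  exact ⟨le_of_lt, fun h => h.lt_of_ne hpq⟩

/-- The group fixes a tournament, in which `p` and `g • p` would dominate each other equally if
`g` interchanged them. -/
lemma smul_eq_of_smul_smul_eq [TopologicalSpace G] [ContinuousInv G]
    (hG : IsExtremelyAmenable.{w, x} G) [Small.{x} Q] [TopologicalSpace Q] [DiscreteTopology Q]
    [ContinuousSMul G Q] {g : G} {p : Q} (h : g • g • p = p) : g • p = p := by
  have := continuousSMul_arrow (G := G) (Q := Q × Q) Bool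
  have := isCompact_iff_compactSpace.1 (isClosed_tournaments (G := G) (Q := Q)).isCompact
  have := nonempty_tournaments (G := G) (Q := Q)
  obtain ⟨⟨R, hR⟩, hfix⟩ := hG.exists_forall_smul_eq (tournaments G Q)
  by_contra hne
  have hswap : R (p, g • p) = R (g • p, p) := by
    have hgp : g⁻¹ • p = g • p := inv_smul_eq_iff.2 h.symm
    have := congrFun (congrArg Subtype.val (hfix g)) (p, g • p)
    exact this.symm.trans (congrArg R (Prod.ext hgp (inv_smul_smul g p)))
  have := hR _ _ hne
  rw [hswap] at this
  exact Bool.eq_not_self _ |>.1 this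

end Tournament

theorem IsExtremelyAmenable.mem_of_mul_self_mem [TopologicalSpace G] [IsTopologicalGroup G]
    (hG : IsExtremelyAmenable.{w, x} G) {H : Subgroup G} (hH : IsOpen (H : Set G))
    [Small.{x} (G ⧸ H)] {g : G} (h : g * g ∈ H) : g ∈ H := by
  have := QuotientGroup.discreteTopology hH
  have hfix : g • g • ((1 : G) : G ⧸ H) = (1 : G) := by
    rw [← mul_smul, MulAction.Quotient.smul_coe, QuotientGroup.eq]
    simpa using H.inv_mem h
  have := smul_eq_of_smul_smul_eq hG hfix
  rw [MulAction.Quotient.smul_coe, QuotientGroup.eq] at this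
  simpa using this

end ExtremelyAmenable

section Automorphisms

variable {L : FirstOrder.Language.{u, v}} {M : Type w} [L.Structure M]

lemma isOpen_setOf_apply_eq (a b : M) : IsOpen {g : Aut L M | g a = b} :=
  TopologicalSpace.isOpen_generateFrom_of_mem ⟨a, b, rfl⟩

lemma isOpen_setOf_comp_eq {n : ℕ} (s t : Fin n → M) : IsOpen {g : Aut L M | g ∘ s = t} := by
  simp only [funext_iff, Set.ofPred_forall]
  exact isOpen_iInter_of_finite fun i => isOpen_setOf_apply_eq (s i) (t i)

instance isTopologicalGroup_aut : IsTopologicalGroup (Aut L M) where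
  continuous_mul := by
    refine continuous_generateFrom_iff.2 ?_
    rintro _ ⟨a, b, rfl⟩
    have h : (fun z : Aut L M × Aut L M => z.1 * z.2) ⁻¹' {g | g a = b} =
        ⋃ c, {g : Aut L M | g c = b} ×ˢ {g : Aut L M | g a = c} := by
      ext ⟨g, g'⟩
      simp only [Set.mem_iUnion, Set.mem_prod]
      exact ⟨fun h => ⟨g' a, h, rfl⟩, fun ⟨c, h, h'⟩ => (congrArg g h').trans h⟩
    rw [h]
    exact isOpen_iUnion fun c => (isOpen_setOf_apply_eq c b).prod (isOpen_setOf_apply_eq a c)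
  continuous_inv := by
    refine continuous_generateFrom_iff.2 ?_
    rintro _ ⟨a, b, rfl⟩
    convert! isOpen_setOf_apply_eq (L := L) b a using 1
    ext g
    exact g.toEquiv.symm_apply_eq.trans eq_comm

theorem rel_comp_of_rel_comp_comp [Countable M] (hG : IsExtremelyAmenable.{w, x} (Aut L M))
    {n : ℕ} {R : (Fin n → M) → (Fin n → M) → Prop} (hR : IsEquivOnSubsets R)
    (hinv : ∀ (g : Aut L M) (s t : Fin n → M), R s t → R (g ∘ s) (g ∘ t)) {g : Aut L M}
    {s : Fin n → M} (h : R s (g ∘ g ∘ s)) : R s (g ∘ s) := by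
  have hs : R s s := hR.trans _ _ _ h (hR.symm _ _ h)
  have hinv' : ∀ {g : Aut L M}, R s (g ∘ s) → R s (⇑g⁻¹ ∘ s) := fun {g} hg => by
    have := hinv g⁻¹ _ _ (hR.symm _ _ hg)
    rwa [← Function.comp_assoc, show ⇑g⁻¹ ∘ ⇑g = id from g.toEquiv.symm_comp_self] at this
  let H : Subgroup (Aut L M) :=
    { carrier := {g | R s (g ∘ s)}
      mul_mem' := fun {g _} hg hg' => hR.trans _ _ _ hg (hinv g _ _ hg')
      one_mem' := hs
      inv_mem' := hinv' }
  have hopen : IsOpen (H : Set (Aut L M)) := by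
    exact H.isOpen_of_mem_nhds <| Filter.mem_of_superset
      ((isOpen_setOf_comp_eq s s).mem_nhds (x := 1) rfl) fun g (hg : g ∘ s = s) =>
        show R s (g ∘ s) from hg.symm ▸ hs
  have hsmall : Small.{x} (Aut L M ⧸ H) := by
    have hinj : Function.Injective fun q : Aut L M ⧸ H => q.out ∘ s := fun q q' hq => by
      rw [← q.out_eq, ← q'.out_eq]
      refine QuotientGroup.eq.2 ?_
      change R s (⇑(q.out⁻¹ * q'.out) ∘ s)
      have hfix : ⇑(q.out⁻¹ * q'.out) ∘ s = s := funext fun i =>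
        q.out.toEquiv.symm_apply_eq.2 (congrFun hq i).symm
      rwa [hfix]
    have := hinj.countable
    infer_instance
  exact hG.mem_of_mul_self_mem hopen h

end Automorphisms

/-! ### Precompact expansions with quantifier elimination -/

section QuantifierElimination

variable {L : FirstOrder.Language.{u, v}} {M : Type w} [L.Structure M]

theorem exists_aut_of_sameIsoType (hu : L.IsUltrahomogeneous M) {k : ℕ} {a b : Fin k → M}
    (h : SameIsoType L a b) : ∃ g : Aut L M, g ∘ a = b := by
  obtain ⟨e, he⟩ := h
  obtain ⟨g, hg⟩ := hu _ (Substructure.fg_closure (Set.finite_range a))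
    ((Substructure.closure L (Set.range b)).subtype.comp e.toEmbedding)
  refine ⟨g, funext fun i => ?_⟩
  have hgi := DFunLike.congr_fun hg ⟨a i, Substructure.subset_closure (Set.mem_range_self i)⟩
  exact hgi.symm.trans (he i)

lemma definable_setOf_relMap {ι : Type*} {m : ℕ} (R : L.Relations m) (z : Fin m → ι) :
    (∅ : Set M).Definable L {a : ι → M | Structure.RelMap R (a ∘ z)} := by
  rw [Set.empty_definable_iff]
  refine ⟨R.formula fun i => Term.var (z i), ?_⟩
  ext a
  simp [Function.comp_def]

lemma definable_setOf_injective (ι : Type*) [Finite ι] :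
    (∅ : Set M).Definable L {a : ι → M | Function.Injective a} := by
  have h : {a : ι → M | Function.Injective a} =
      ⋂ p : {p : ι × ι // p.1 ≠ p.2}, {a : ι → M | a p.1.1 = a p.1.2}ᶜ := by
    ext a
    simp [Function.Injective, not_imp_not]
  rw [h]
  refine Set.definable_iInter_of_finite fun p => .compl ?_
  rw [Set.empty_definable_iff]
  refine ⟨(Term.var p.1.1).equal (Term.var p.1.2), ?_⟩
  ext a
  simp

variable [L.IsRelational]

lemma tupleStructure_eq_iff {N : Type*} [L.Structure N] {ι : Type*} {a : ι → M} {b : ι → N} :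
    tupleStructure L a = tupleStructure L b ↔ ∀ (m : ℕ) (R : L.Relations m) (z : Fin m → ι),
      Structure.RelMap R (a ∘ z) ↔ Structure.RelMap R (b ∘ z) :=
  ⟨fun h _ R z => iff_of_eq (congrArg (fun S : L.Structure ι => S.RelMap R z) h),
    fun h => Structure.ext (funext fun _ => funext fun f => isEmptyElim f)
      (funext fun m => funext fun R => funext fun z => propext (h m R z))⟩

lemma realize_iff_of_tupleStructure_eq {ι : Type*} {a b : ι → M} (ha : Function.Injective a)
    (hb : Function.Injective b) (h : tupleStructure L a = tupleStructure L b) {ψ : L.Formula ι}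
    (hψ : BoundedFormula.IsQF ψ) : ψ.Realize a ↔ ψ.Realize b := by
  have key : ∀ (c : ι → M), Function.Injective c →
      (ψ.Realize c ↔ @Formula.Realize L ι (tupleStructure L c) _ ψ id) := fun c hc => by
    let := tupleStructure L c
    let e : ι ↪[L] M := ⟨⟨c, hc⟩, fun f => isEmptyElim f, fun _ _ => Iff.rfl⟩
    rw [Formula.Realize, Formula.Realize, ← hψ.realize_embedding e (v := id) (xs := default),
      Subsingleton.elim (e ∘ default) default]
    rfl
  rw [key a ha, key b hb, h]

lemma exists_definable_separating {ι : Type*} {a c : ι → M}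
    (h : tupleStructure L c ≠ tupleStructure L a) :
    ∃ T : Set (ι → M), (∅ : Set M).Definable L T ∧
      (∀ b, tupleStructure L b = tupleStructure L a → b ∈ T) ∧
      ∀ b, tupleStructure L b = tupleStructure L c → b ∉ T := by
  simp only [ne_eq, tupleStructure_eq_iff (a := c), not_forall] at h
  obtain ⟨m, R, z, hz⟩ := h
  refine ⟨{b | Structure.RelMap R (b ∘ z) ↔ Structure.RelMap R (a ∘ z)}, ?_,
    fun b hb => tupleStructure_eq_iff.1 hb m R z,
    fun b hb hbT => hz ((tupleStructure_eq_iff.1 hb m R z).symm.trans hbT)⟩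
  have hR := definable_setOf_relMap (M := M) R z
  by_cases ha : Structure.RelMap R (a ∘ z)
  · simpa only [ha, iff_true] using hR
  · simpa only [ha, iff_false, Set.compl_ofPred] using hR.compl

lemma definable_setOf_tupleStructure_eq {ι : Type*} [Finite ι]
    (hfin : (tupleStructure L '' {a : ι → M | Function.Injective a}).Finite) (a : ι → M) :
    (∅ : Set M).Definable L
      {b : ι → M | Function.Injective b ∧ tupleStructure L b = tupleStructure L a} := by
  let D := tupleStructure L '' {c : ι → M | Function.Injective c} \ {tupleStructure L a}
  have : Finite D := hfin.sdiff
  have hsep : ∀ S : D, ∃ T : Set (ι → M), (∅ : Set M).Definable L T ∧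
      (∀ b, tupleStructure L b = tupleStructure L a → b ∈ T) ∧
      ∀ b, tupleStructure L b = S → b ∉ T := by
    rintro ⟨_, ⟨c, -, rfl⟩, hne⟩
    exact exists_definable_separating hne
  choose T hT hmem hnot using hsep
  have heq : {b : ι → M | Function.Injective b ∧ tupleStructure L b = tupleStructure L a} =
      {b : ι → M | Function.Injective b} ∩ ⋂ S : D, T S := by
    ext b
    refine and_congr_right fun hb => ⟨fun h => Set.mem_iInter.2 fun S => hmem S b h, fun h => ?_⟩
    by_contra hne
    exact hnot ⟨_, ⟨b, hb, rfl⟩, hne⟩ b rfl (Set.mem_iInter.1 h _)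
  rw [heq]
  exact (definable_setOf_injective ι).inter (Set.definable_iInter_of_finite hT)

section Extension

variable (hqe : HasQE L M)
  (hfin : ∀ k : ℕ, (tupleStructure L '' {a : Fin k → M | Function.Injective a}).Finite)
include hqe hfin

lemma exists_snoc_tupleStructure_eq {k : ℕ} {a b : Fin k → M} (hb : Function.Injective b)
    (h : tupleStructure L a = tupleStructure L b) {c : M}
    (hc : Function.Injective (Fin.snoc a c : Fin (k + 1) → M)) :
    ∃ d : M, Function.Injective (Fin.snoc b d : Fin (k + 1) → M) ∧
      tupleStructure L (Fin.snoc b d : Fin (k + 1) → M) =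
        tupleStructure L (Fin.snoc a c : Fin (k + 1) → M) := by
  have hinit : (Fin.snoc a c : Fin (k + 1) → M) ∘ Fin.castSucc = a :=
    Fin.init_snoc (α := fun _ => M) c a
  obtain ⟨θ, hθ⟩ := Set.empty_definable_iff.1 <|
    (definable_setOf_tupleStructure_eq (hfin (k + 1)) (Fin.snoc a c)).image_comp Fin.castSucc
  obtain ⟨ψ, hψ, hiff⟩ := hqe k θ
  have ha : θ.Realize a := hθ.le ⟨_, ⟨hc, rfl⟩, hinit⟩
  have hθb : θ.Realize b := (hiff b).2 <| (realize_iff_of_tupleStructure_eq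
    (hinit ▸ hc.comp (Fin.castSucc_injective k)) hb h hψ).1 ((hiff a).1 ha)
  obtain ⟨f, hf, rfl⟩ := hθ.ge hθb
  have hsnoc : (Fin.snoc (f ∘ Fin.castSucc) (f (Fin.last k)) : Fin (k + 1) → M) = f :=
    Fin.snoc_init_self f
  exact ⟨f (Fin.last k), hsnoc.symm ▸ hf⟩

theorem isUltrahomogeneous_of_hasQE [Countable M] : L.IsUltrahomogeneous M := by
  rw [isUltrahomogeneous_iff_IsExtensionPair Structure.cg_of_countable]
  intro f m
  by_cases hm : m ∈ f.1.dom
  · exact ⟨f, hm, le_rfl⟩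
  have : Finite f.1.dom := f.2.finite
  obtain ⟨k, ⟨j⟩⟩ := Finite.exists_equiv_fin f.1.dom
  let a : Fin k → M := fun i => j.symm i
  let b : Fin k → M := fun i => f.1.toEquiv (j.symm i)
  have hb : Function.Injective b :=
    Subtype.val_injective.comp (f.1.toEquiv.injective.comp j.symm.injective)
  have hab : tupleStructure L a = tupleStructure L b :=
    tupleStructure_eq_iff.2 fun l R z => (f.1.toEquiv.map_rel R (j.symm ∘ z)).symm
  have hc : Function.Injective (Fin.snoc a m : Fin (k + 1) → M) := by
    refine Fin.snoc_injective_iff.2 ⟨Subtype.val_injective.comp j.symm.injective, ?_⟩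
    rintro ⟨i, rfl⟩
    exact hm (j.symm i).2
  obtain ⟨d, hd, hd'⟩ := exists_snoc_tupleStructure_eq hqe hfin hb hab hc
  obtain ⟨g, hdom, -, hg⟩ :=
    exists_partialEquiv_of_relMap_iff hc hd (tupleStructure_eq_iff.1 hd'.symm)
  have hmem : ∀ i, (Fin.snoc a m : Fin (k + 1) → M) i ∈ g.dom := fun i => hdom.ge ⟨i, rfl⟩
  have ha : ∀ i, a i ∈ g.dom := fun i => by simpa using hmem i.castSucc
  have hle : f.1.dom ≤ g.dom := fun p hp => by simpa [a] using ha (j ⟨p, hp⟩)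
  have hfg : g.dom.FG := ⟨(Set.finite_range _).toFinset, by
    rw [Set.Finite.coe_toFinset, ← hdom, Substructure.closure_eq]⟩
  refine ⟨⟨g, hfg⟩, by simpa using hmem (Fin.last k), (PartialEquiv.le_def _ _).2 ⟨hle, ?_⟩⟩
  ext p
  obtain ⟨i, rfl⟩ := j.symm.surjective p
  simpa using hg i.castSucc (hmem _)

end Extension

end QuantifierElimination

section Precompact

variable {P : Set ℕ} {hP : ∀ n ∈ P, 3 ≤ n}

lemma finite_setOf_mem_classK (ι : Type w) [Finite ι] :
    {S : (langP P).Structure ι |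
      (⟨ι, S⟩ : CategoryTheory.Bundled.{w} (langP P).Structure) ∈ classK P hP}.Finite := by
  have hlab : ∀ S : {S : (langP P).Structure ι |
      (⟨ι, S⟩ : CategoryTheory.Bundled.{w} (langP P).Structure) ∈ classK P hP},
      ∃ lab : Set ι → ℕ, @IsLabelledBy P ι S _ _ _ id lab := fun S =>
    let := S.1
    (IsKStructure.of_mem_classK (hP := hP) S.2).exists_isLabelledBy_id
  choose lab h using hlab
  refine Set.finite_coe_iff.1 <| Finite.of_injective
    (fun S (A B : Set ι) => (lab S A = lab S B, lab S A < lab S B)) fun S S' hSS' => ?_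
  have hsim : LabelSimilar P (lab S) (lab S') :=
    ⟨fun A B _ => iff_of_eq (congrArg Prod.fst (congrFun (congrFun hSS' A) B)),
      fun A B _ _ => iff_of_eq (congrArg Prod.snd (congrFun (congrFun hSS' A) B))⟩
  refine Subtype.ext (Structure.ext (funext fun _ => funext fun f => f.elim) ?_)
  funext m R z
  exact propext (@IsLabelledBy.relMap_iff P ι S ι _ _ _ _ id _ ι S' id _ (h S) (h S') hsim m R z)

variable {L : FirstOrder.Language.{u, v}} {M : Type w} [L.Structure M]

lemma tupleStructure_mem_age [L.IsRelational] {ι : Type w} [Finite ι] {a : ι → M}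
    (ha : Function.Injective a) :
    (⟨ι, tupleStructure L a⟩ : CategoryTheory.Bundled.{w} L.Structure) ∈ L.age M := by
  let := tupleStructure L a
  exact ⟨Structure.FG.of_finite, ⟨⟨a, ha⟩, fun f => isEmptyElim f, fun _ _ => Iff.rfl⟩⟩

lemma exists_reduct_aut {L' : FirstOrder.Language.{x, y}} [L'.Structure M] (φ : L →ᴸ L')
    [φ.IsExpansionOn M] (g : Aut L' M) : ∃ g' : Aut L M, ⇑g' = g := by
  refine ⟨⟨g.toEquiv, fun f z => ?_, fun R z => ?_⟩, rfl⟩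
  · rw [← LHom.map_onFunction φ, ← LHom.map_onFunction φ]
    exact g.map_fun _ _
  · rw [← LHom.map_onRelation φ, ← LHom.map_onRelation φ]
    exact g.map_rel _ _

variable [Countable M] [(langP P).Structure M] {φ : langP P →ᴸ L} [φ.IsExpansionOn M]

lemma finite_image_tupleStructure [L.IsRelational] (hM : IsFraisseLimit (classK.{w} P hP) M)
    (hpre : IsPrecompactExpansion φ M) (k : ℕ) :
    (tupleStructure L '' {a : Fin k → M | Function.Injective a}).Finite := by
  let ι := ULift.{w} (Fin k)
  let D : Set (L.Structure ι) := tupleStructure L '' {a : ι → M | Function.Injective a}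
  have hD : D.Finite := by
    refine ((finite_setOf_mem_classK (hP := hP) ι).biUnion fun S₀ hS₀ =>
      hpre ⟨ι, S₀⟩ (hM.age ▸ hS₀)).subset ?_
    rintro _ ⟨a, ha, rfl⟩
    have hmem : (⟨ι, tupleStructure (langP P) a⟩ : CategoryTheory.Bundled.{w} _) ∈ classK P hP :=
      hM.age ▸ tupleStructure_mem_age ha
    exact Set.mem_biUnion hmem
      ⟨@LHom.IsExpansionOn.mk _ _ φ _ (tupleStructure (langP P) a) (tupleStructure L a)
        (fun f => f.elim) fun R z => LHom.map_onRelation φ R (a ∘ z), tupleStructure_mem_age ha⟩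
  refine (hD.image fun S => @tupleStructure L _ ι S _ ULift.up).subset ?_
  rintro _ ⟨a, ha, rfl⟩
  exact ⟨_, ⟨a ∘ ULift.down, ha.comp ULift.down_injective, rfl⟩, rfl⟩

lemma relE_comp_of_relE_comp_comp (φ : langP P →ᴸ L) [φ.IsExpansionOn M] (hM : IsKStructure P M)
    (hG : IsExtremelyAmenable.{w, x} (Aut L M)) {n : ℕ} {hn : 0 < n} {g : Aut L M} {s : Fin n → M}
    (h : relE P n hn s (g ∘ g ∘ s)) : relE P n hn s (g ∘ s) := by
  refine rel_comp_of_rel_comp_comp hG (hM.equiv n hn) (fun g s t => ?_) h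
  obtain ⟨g', hg'⟩ := exists_reduct_aut φ g
  exact hg' ▸ (relE_embedding g'.toEmbedding n hn s t).2

theorem not_exists_isIncreasingZ4 [L.IsRelational] (hM : IsFraisseLimit (classK.{w} P hP) M)
    (φ : langP P →ᴸ L) [φ.IsExpansionOn M] (hpre : IsPrecompactExpansion φ M) (hqe : HasQE L M)
    (hG : IsExtremelyAmenable.{w, x} (Aut L M)) (n : ℕ) (hn : 0 < n) :
    ¬ ∃ a : Fin 6 → (Fin n → M), IsIncreasingZ4 P L n hn a := by
  rintro ⟨a, -, -, h, hE, hnE⟩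
  have hu := isUltrahomogeneous_of_hasQE hqe (finite_image_tupleStructure hM hpre)
  obtain ⟨g, hg⟩ := exists_aut_of_sameIsoType hu h
  rw [← append_comp_apply] at hg
  have h₂ : g ∘ Fin.append (a 0) (a 1) = Fin.append (a 2) (a 3) := by
    simpa only [append_comp_castAdd] using congrArg (· ∘ Fin.castAdd (n + n)) hg
  have h₄ : g ∘ Fin.append (a 2) (a 3) = Fin.append (a 4) (a 5) := by
    simpa only [append_comp_natAdd] using congrArg (· ∘ Fin.natAdd (n + n)) hg
  rw [← h₂] at hnE
  rw [← h₄, ← h₂] at hE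
  exact hnE (relE_comp_of_relE_comp_comp φ (isKStructure_of_isFraisseLimit hM) hG hE)

end Precompact

/-! ### Expansions by a linear order -/

section PairLabel

variable {A : Type*}

/-- The labelling of sets that labels the points by `f` and the pairs by `c`; larger sets of the
same size are not distinguished. -/
noncomputable def pairLabel (f : A → ℕ) (c : A → A → ℕ) (S : Set A) : ℕ :=
  if S.ncard = 1 then sInf (f '' S)
  else if S.ncard = 2 then sInf ((fun z => c z.1 z.2) '' S.offDiag) else 0

variable {f f' : A → ℕ} {c c' : A → A → ℕ}

lemma pairLabel_singleton (p : A) : pairLabel f c {p} = f p := by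
  simp [pairLabel]

lemma pairLabel_pair (hc : ∀ p q, c p q = c q p) {p q : A} (hpq : p ≠ q) :
    pairLabel f c {p, q} = c p q := by
  have hcard := Set.ncard_pair hpq
  have hoff : Set.offDiag ({p, q} : Set A) = {(p, q), (q, p)} := by
    ext ⟨x, y⟩
    simp only [Set.mem_offDiag, Set.mem_insert_iff, Set.mem_singleton_iff, Prod.mk.injEq]
    grind
  simp [pairLabel, hcard, hoff, Set.image_pair, hc q p]

lemma pairLabel_image {B : Type*} {α : B → A} (hα : Function.Injective α) (S : Set B) :
    pairLabel f c (α '' S) = pairLabel (f ∘ α) (fun p q => c (α p) (α q)) S := by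
  have hoff : (α '' S).offDiag = Prod.map α α '' S.offDiag := by
    ext ⟨x, y⟩
    simp only [Set.mem_offDiag, Set.mem_image, Prod.exists, Prod.map_apply, Prod.mk.injEq]
    grind [Function.Injective]
  simp only [pairLabel, Set.ncard_image_of_injective S hα, Set.image_image, hoff]
  rfl

lemma labelSimilar_pairLabel {P : Set ℕ} (hP : ∀ n ∈ P, 3 ≤ n) (hc : ∀ p q, c p q = c q p)
    (hc' : ∀ p q, c' p q = c' q p) (hf : ∀ p q, f p = f q ↔ f' p = f' q)
    (hcc' : ∀ p q r s, c p q = c r s ↔ c' p q = c' r s) :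
    LabelSimilar P (pairLabel f c) (pairLabel f' c') where
  eq_iff S T hST := by
    by_cases h₁ : S.ncard = 1
    · obtain ⟨p, rfl⟩ := Set.ncard_eq_one.1 h₁
      obtain ⟨q, rfl⟩ := Set.ncard_eq_one.1 (hST ▸ h₁)
      simpa only [pairLabel_singleton] using hf p q
    by_cases h₂ : S.ncard = 2
    · obtain ⟨p, q, hpq, rfl⟩ := Set.ncard_eq_two.1 h₂
      obtain ⟨r, s, hrs, rfl⟩ := Set.ncard_eq_two.1 (hST ▸ h₂)
      simpa only [pairLabel_pair hc, pairLabel_pair hc', hpq, hrs, ne_eq, not_false_eq_true]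
        using hcc' p q r s
    · simp only [pairLabel, ← hST, h₁, h₂, if_false]
  lt_iff S T hn hST := by
    have h₁ : S.ncard ≠ 1 := by have := hP _ hn; omega
    have h₂ : S.ncard ≠ 2 := by have := hP _ hn; omega
    simp only [pairLabel, ← hST, h₁, h₂, if_false]

end PairLabel

section OrderHomogeneous

variable {L : FirstOrder.Language.{u, v}} {L' : FirstOrder.Language.{x, y}} {M : Type w}
  [L.Structure M] [L'.Structure M] [LinearOrder M]

variable (L L' M) in
/-- Increasing tuples with the same `L`-relations are conjugate under `L'`-automorphisms. For
`L'`-structures interdefinable with the expansion of an `L`-structure by a linear order this is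
ultrahomogeneity. -/
def IsOrderHomogeneous : Prop :=
  ∀ (k : ℕ) (a b : Fin k → M), StrictMono a → StrictMono b →
    (∀ (m : ℕ) (R : L.Relations m) (z : Fin m → Fin k),
      Structure.RelMap R (a ∘ z) ↔ Structure.RelMap R (b ∘ z)) →
    ∃ g : Aut L' M, ∀ i, g (a i) = b i

end OrderHomogeneous

lemma isOrderHomogeneous_orderExpansion {L : FirstOrder.Language.{u, v}} [L.IsRelational]
    {M : Type w} [L.Structure M] (o : LinearOrder M) :
    let := orderExpansion L M o
    (L.sum FirstOrder.Language.order).IsUltrahomogeneous M →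
      IsOrderHomogeneous L (L.sum FirstOrder.Language.order) M := by
  intro _ hu k a b ha hb h
  refine exists_aut_of_relMap_iff hu ha.injective hb.injective ?_
  rintro m (R | R) z
  · exact h m R z
  · cases R
    change a (z 0) ≤ a (z 1) ↔ b (z 0) ≤ b (z 1)
    rw [ha.le_iff_le, hb.le_iff_le]

section Convexity

lemma lt_of_rel_of_rel {α : Type*} [LinearOrder α] {r : α → α → Prop} (hr : Equivalence r)
    (hconv : ∀ p q s, p < q → q < s → r p s → r p q) {p p' q q' : α} (hp : r p p') (hq : r q q')
    (hpq : ¬ r p q) (h : p < q) : p' < q' := by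
  have h₁ : p' < q := by
    by_contra! hle
    obtain rfl | hlt := hle.eq_or_lt
    · exact hpq hp
    · exact hpq (hconv p q p' h hlt hp)
  by_contra! hle
  obtain rfl | hlt := hle.eq_or_lt
  · exact hpq (hr.trans hp (hr.symm hq))
  · exact hpq (hr.trans hp (hr.symm (hr.trans hq (hconv q' p' q hlt h₁ (hr.symm hq)))))

variable {P : Set ℕ} {M : Type w} [(langP P).Structure M]

variable (P) in
/-- The relation `E_1`, as a relation between elements. -/
def relE₁ (p q : M) : Prop := relE P 1 Nat.one_pos (fun _ => p) fun _ => q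

lemma IsKStructure.equivalence_relE₁ (hM : IsKStructure P M) : Equivalence (relE₁ P (M := M)) :=
  have h := hM.equiv 1 Nat.one_pos
  ⟨fun _ => h.perm _ (Function.injective_of_subsingleton _) 1, h.symm _ _, h.trans _ _ _⟩

lemma IsLabelledBy.relE₁_iff {A κ : Type*} [LinearOrder κ] {v : A → M} {lab : Set A → κ}
    (h : IsLabelledBy P v lab) (p q : A) : relE₁ P (v p) (v q) ↔ lab {p} = lab {q} := by
  refine (h.relE_iff 1 Nat.one_pos (fun _ => p) fun _ => q).trans ?_
  simp only [Function.injective_of_subsingleton, Set.range_const, true_and]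

/-- On two points only the labels of the singletons matter, since all members of `P` are at
least `3`. -/
lemma labelSimilar_fin_two {κ κ' : Type*} [LinearOrder κ] [LinearOrder κ']
    (hP : ∀ n ∈ P, 3 ≤ n) {lab : Set (Fin 2) → κ} {lab' : Set (Fin 2) → κ'}
    (h : lab {0} = lab {1} ↔ lab' {0} = lab' {1}) : LabelSimilar P lab lab' where
  eq_iff S T hST := by
    by_cases h₁ : S.ncard = 1
    · obtain ⟨i, rfl⟩ := Set.ncard_eq_one.1 h₁
      obtain ⟨j, rfl⟩ := Set.ncard_eq_one.1 (hST ▸ h₁)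
      fin_cases i <;> fin_cases j <;> grind
    · have hST' : S = T := by
        have h₂ : S.ncard ≤ 2 := (Set.ncard_le_card S).trans_eq (Nat.card_fin 2)
        obtain h₀ | h₂ : S.ncard = 0 ∨ S.ncard = 2 := by omega
        · rw [(Set.ncard_eq_zero S.toFinite).1 h₀, (Set.ncard_eq_zero T.toFinite).1 (hST ▸ h₀)]
        · have huniv : ∀ U : Set (Fin 2), U.ncard = 2 → U = Set.univ := fun U hU =>
            Set.eq_of_subset_of_ncard_le (Set.subset_univ U) (by simp [hU])
          rw [huniv S h₂, huniv T (hST ▸ h₂)]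
      rw [hST', iff_true_right rfl]
  lt_iff S T hn _ := by
    have h₂ : S.ncard ≤ 2 := (Set.ncard_le_card S).trans_eq (Nat.card_fin 2)
    have := hP _ hn
    omega

variable {L : FirstOrder.Language.{u, v}} [L.Structure M] [LinearOrder M]

lemma IsOrderHomogeneous.exists_aut (hhom : IsOrderHomogeneous (langP P) L M) {κ κ' : Type*}
    [LinearOrder κ] [LinearOrder κ'] {k : ℕ} {a b : Fin k → M} {lab : Set (Fin k) → κ}
    {lab' : Set (Fin k) → κ'} (ha : StrictMono a) (hb : StrictMono b) (h : IsLabelledBy P a lab)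
    (h' : IsLabelledBy P b lab') (hsim : LabelSimilar P lab lab') :
    ∃ g : Aut L M, ∀ i, g (a i) = b i :=
  hhom k a b ha hb (h.relMap_iff h' hsim)

/-- Otherwise an automorphism maps `p` to `q` and `q` to `r`, although the class of `p` contains
`r` but not `q`. -/
lemma relE₁_of_lt_of_lt {hP : ∀ n ∈ P, 3 ≤ n} [Countable M] (φ : langP P →ᴸ L) [φ.IsExpansionOn M]
    (hM : IsFraisseLimit (classK.{w} P hP) M) (hhom : IsOrderHomogeneous (langP P) L M)
    (hG : IsExtremelyAmenable.{w, x} (Aut L M)) {p q r : M} (hpq : p < q) (hqr : q < r)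
    (hpr : relE₁ P p r) : relE₁ P p q := by
  by_contra hne
  have hK := isKStructure_of_isFraisseLimit hM
  have hne' : ¬ relE₁ P q r := fun h =>
    hne (hK.equivalence_relE₁.trans hpr (hK.equivalence_relE₁.symm h))
  have hmono : ∀ {p q : M}, p < q → StrictMono ![p, q] := fun h =>
    Fin.strictMono_iff_lt_succ.2 fun i => by fin_cases i; exact h
  obtain ⟨k, lab, hlab⟩ := hK.exists_isLabelledBy (hmono hpq).injective
  obtain ⟨k', lab', hlab'⟩ := hK.exists_isLabelledBy (hmono hqr).injective
  have hsim : LabelSimilar P lab lab' := labelSimilar_fin_two hP <|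
    iff_of_false (mt (hlab.relE₁_iff 0 1).2 hne) (mt (hlab'.relE₁_iff 0 1).2 hne')
  obtain ⟨g, hg⟩ := hhom.exists_aut (hmono hpq) (hmono hqr) hlab hlab' hsim
  obtain rfl : g p = q := hg 0
  obtain rfl : g (g p) = r := hg 1
  exact hne (relE_comp_of_relE_comp_comp φ hK hG (s := fun _ => p) hpr)

end Convexity

section Edges

variable {P : Set ℕ} {hP : ∀ n ∈ P, 3 ≤ n} {M : Type w} [Countable M] [(langP P).Structure M]

/-- Twelve points in three blocks; each block contains one edge of each of two colours. -/
abbrev EdgePoint : Type := Fin 3 × Fin 2 × Fin 2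

/-- The colour of a pair of points, `0` if the pair is not an edge. -/
def edgeColour (p q : EdgePoint) : ℕ := if p.1 = q.1 ∧ p.2.1 = q.2.1 then p.2.1 + 1 else 0

lemma edgeColour_comm : ∀ p q, edgeColour p q = edgeColour q p := by
  unfold edgeColour
  grind

/-- The edge of colour `c + 1` in the block `i`, as a pair of points. -/
def edge (i : Fin 3) (c x : Fin 2) : EdgePoint := (i, c, x)

lemma edge_injective (i : Fin 3) (c : Fin 2) : Function.Injective (edge i c) :=
  fun x y h => by simpa [edge] using h

lemma pairLabel_range_edge (f : EdgePoint → ℕ) (i : Fin 3) (c : Fin 2) :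
    pairLabel f edgeColour (Set.range (edge i c)) = c + 1 := by
  have hr : Set.range (edge i c) = {edge i c 0, edge i c 1} := by
    ext p
    simp [Fin.exists_fin_two, eq_comm]
  rw [hr, pairLabel_pair edgeColour_comm ((edge_injective i c).ne (by decide))]
  simp [edge, edgeColour]

/-- The increasing configuration is obtained from any copy of the points by sorting the blocks and
orienting the edges. -/
lemma exists_increasing_edges [LinearOrder M] (hM : IsFraisseLimit (classK.{w} P hP) M)
    (hconv : ∀ p q r : M, p < q → q < r → relE₁ P p r → relE₁ P p q) :
    ∃ (v : EdgePoint → M) (f : Fin 3 → ℕ), Function.Injective f ∧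
      IsLabelledBy P v (pairLabel (fun p => f p.1) edgeColour) ∧
      (∀ i c, v (i, c, 0) < v (i, c, 1)) ∧
      ∀ i j, i < j → ∀ z z', v (i, z) < v (j, z') := by
  obtain ⟨v, hv⟩ := exists_isLabelledBy hM (pairLabel (fun p : EdgePoint => p.1) edgeColour)
  have horient : ∀ (i : Fin 3) (c : Fin 2), ∃ τ : Equiv.Perm (Fin 2),
      v (i, c, τ 0) < v (i, c, τ 1) := fun i c => by
    have hne : v (i, c, 0) ≠ v (i, c, 1) := hv.injective.ne (by simp)
    exact hne.lt_or_gt.elim (fun h => ⟨1, h⟩) fun h => ⟨Equiv.swap 0 1, h⟩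
  choose τ hτ using horient
  let σ := Tuple.sort fun i => v (i, 0, 0)
  have hσ : StrictMono ((fun i => v (i, 0, 0)) ∘ σ) :=
    (Tuple.monotone_sort _).strictMono_of_injective <|
      hv.injective.comp fun i j h => σ.injective (congrArg Prod.fst h)
  let ρ : EdgePoint → EdgePoint := fun p => (σ p.1, p.2.1, τ (σ p.1) p.2.1 p.2.2)
  have hρ : Function.Injective ρ := by
    rintro ⟨i, c, x⟩ ⟨j, d, y⟩ h
    obtain ⟨hij, rfl, hxy⟩ : σ i = σ j ∧ c = d ∧ τ (σ i) c x = τ (σ j) d y := by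
      simpa only [ρ, Prod.mk.injEq] using h
    obtain rfl := σ.injective hij
    obtain rfl := (τ _ _).injective hxy
    rfl
  refine ⟨v ∘ ρ, fun i => σ i, Fin.val_injective.comp σ.injective, ?_, fun i c => hτ _ _,
    fun i j hij z z' => ?_⟩
  · convert! hv.comp hρ using 1
    funext S
    rw [pairLabel_image hρ]
    congr 1
    funext p q
    simp only [edgeColour, ρ, σ.injective.eq_iff]
  · have hE : ∀ p q : EdgePoint, relE₁ P (v p) (v q) ↔ p.1 = q.1 := fun p q => by
      rw [hv.relE₁_iff, pairLabel_singleton, pairLabel_singleton, Fin.val_inj]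
    exact lt_of_rel_of_rel (isKStructure_of_isFraisseLimit hM).equivalence_relE₁ hconv
      ((hE (σ i, 0, 0) _).2 rfl) ((hE (σ j, 0, 0) _).2 rfl)
      (mt (hE _ _).1 (σ.injective.ne hij.ne)) (hσ hij)

theorem not_isExtremelyAmenable_of_isOrderHomogeneous {L : FirstOrder.Language.{u, v}}
    [L.Structure M] [LinearOrder M] (φ : langP P →ᴸ L) [φ.IsExpansionOn M]
    (hM : IsFraisseLimit (classK.{w} P hP) M) (hhom : IsOrderHomogeneous (langP P) L M) :
    ¬ IsExtremelyAmenable.{w, x} (Aut L M) := by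
  intro hG
  obtain ⟨v, f, hf, hv, hedge, hblock⟩ := exists_increasing_edges hM fun _ _ _ =>
    relE₁_of_lt_of_lt φ hM hhom hG
  let α : Fin 4 → EdgePoint := ![(0, 0, 0), (0, 0, 1), (1, 1, 0), (1, 1, 1)]
  let β : Fin 4 → EdgePoint := ![(1, 1, 0), (1, 1, 1), (2, 0, 0), (2, 0, 1)]
  have hα : StrictMono (v ∘ α) := Fin.strictMono_iff_lt_succ.2 fun i => by
    fin_cases i
    exacts [hedge _ _, hblock 0 1 (by decide) _ _, hedge _ _]
  have hβ : StrictMono (v ∘ β) := Fin.strictMono_iff_lt_succ.2 fun i => by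
    fin_cases i
    exacts [hedge _ _, hblock 1 2 (by decide) _ _, hedge _ _]
  have hsim : LabelSimilar P (fun S => pairLabel (fun p => f p.1) edgeColour (α '' S))
      fun S => pairLabel (fun p => f p.1) edgeColour (β '' S) := by
    simp only [pairLabel_image hα.injective.of_comp, pairLabel_image hβ.injective.of_comp]
    refine labelSimilar_pairLabel hP (fun _ _ => edgeColour_comm _ _)
      (fun _ _ => edgeColour_comm _ _) ?_ (by decide)
    simp only [Function.comp_apply, hf.eq_iff]
    decide
  obtain ⟨g, hg⟩ := hhom.exists_aut hα hβ (hv.comp hα.injective.of_comp)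
    (hv.comp hβ.injective.of_comp) hsim
  have hg₁ : g ∘ v ∘ edge 0 0 = v ∘ edge 1 1 := funext fun x => by
    fin_cases x
    exacts [hg 0, hg 1]
  have hg₂ : g ∘ v ∘ edge 1 1 = v ∘ edge 2 0 := funext fun x => by
    fin_cases x
    exacts [hg 2, hg 3]
  have key := relE_comp_of_relE_comp_comp φ (isKStructure_of_isFraisseLimit hM) hG (n := 2)
    (hn := Nat.two_pos) (g := g) (s := v ∘ edge 0 0)
  simp only [hg₁, hg₂, hv.relE_iff, pairLabel_range_edge] at key
  simp [edge_injective] at key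

theorem not_exists_linearOrder (hM : IsFraisseLimit (classK.{w} P hP) M) :
    ¬ ∃ o : LinearOrder M,
      letI := orderExpansion (langP P) M o
      ((langP P).sum FirstOrder.Language.order).IsUltrahomogeneous M ∧
        IsExtremelyAmenable.{w, x} (Aut ((langP P).sum FirstOrder.Language.order) M) := by
  rintro ⟨o, hu, hG⟩
  let := orderExpansion (langP P) M o
  have : (LHom.sumInl : langP P →ᴸ (langP P).sum FirstOrder.Language.order).IsExpansionOn M :=
    ⟨fun _ _ => rfl, fun _ _ => rfl⟩
  exact not_isExtremelyAmenable_of_isOrderHomogeneous LHom.sumInl hM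
    (isOrderHomogeneous_orderExpansion o hu) hG

end Edges

/-! ### Extending partial isomorphisms of labelled sets -/

section Valuation

lemma exists_perm_apply_eq {I B : Type*} [Finite B] (a b : I → B)
    (h : ∀ i j, a i = a j ↔ b i = b j) : ∃ π : Equiv.Perm B, ∀ i, π (a i) = b i := by
  classical
  let e : Set.range a ≃ Set.range b := (Setoid.quotientKerEquivRange a).symm.trans
    ((Quotient.congrRight h).trans (Setoid.quotientKerEquivRange b))
  have he : ∀ i, e ⟨a i, i, rfl⟩ = ⟨b i, i, rfl⟩ := fun i => by
    have hi : (Setoid.quotientKerEquivRange a).symm ⟨a i, i, rfl⟩ = Quotient.mk _ i :=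
      (Equiv.symm_apply_eq _).2 rfl
    simp only [e, Equiv.trans_apply, hi]
    rfl
  refine ⟨e.extendSubtype, fun i => ?_⟩
  rw [Equiv.extendSubtype_apply_of_mem e _ ⟨i, rfl⟩, he]

variable {B : Type y} {R : Type*} [AddCommGroup R]

open Classical in
/-- The function whose only nonzero value is `r`, at a chosen point of `S`. -/
noncomputable def pointMass (S : Set B) (r : R) : B → R :=
  if h : S.Nonempty then Pi.single h.some r else 0

lemma finsum_pointMass {S : Set B} (hS : S.Nonempty) (r : R) :
    ∑ᶠ p ∈ S, pointMass S r p = r := by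
  classical
  simp only [pointMass, dif_pos hS]
  rw [finsum_eq_single _ hS.some fun p hp => by simp only [Pi.single_eq_of_ne hp, finsum_zero],
    finsum_eq_if, if_pos hS.some_mem, Pi.single_eq_same]

variable (B R) in
/-- Points of `B` together with a valuation of all subsets of `B`. They carry a labelled
structure in which every partial isomorphism between copies of subsets of `B` extends to an
automorphism. -/
abbrev ValuedPoint : Type _ := B × (Set B → R)

open Classical in
/-- The label of a set of valued points which projects injectively to `B` is the sum of the values
at its projection. -/
noncomputable def valuationLabel (T : Set (ValuedPoint B R)) : R :=
  if Set.InjOn Prod.fst T then ∑ᶠ p ∈ T, p.2 (Prod.fst '' T) else 0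

/-- The permutation of the valued points that permutes `B` by `π` and corrects the valuations by
`τ`. -/
def shiftPerm (π : Equiv.Perm B) (τ : B → Set B → R) : Equiv.Perm (ValuedPoint B R) where
  toFun p := (π p.1, fun S => p.2 (π ⁻¹' S) + τ p.1 (π ⁻¹' S))
  invFun p := (π.symm p.1, fun S => p.2 (π '' S) - τ (π.symm p.1) S)
  left_inv p := by
    simp only [Set.preimage_image_eq _ π.injective, π.symm_apply_apply, add_sub_cancel_right]
  right_inv p := by
    simp only [Set.image_preimage_eq _ π.surjective, π.apply_symm_apply, sub_add_cancel]

lemma valuationLabel_shiftPerm_image [Finite B] (π : Equiv.Perm B) {τ : B → Set B → R}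
    (hτ : ∀ S, ∑ᶠ p ∈ S, τ p S = 0) (T : Set (ValuedPoint B R)) :
    valuationLabel (shiftPerm π τ '' T) = valuationLabel T := by
  have hfst : Prod.fst '' (shiftPerm π τ '' T) = π '' (Prod.fst '' T) := by
    simp only [Set.image_image, shiftPerm, Equiv.coe_fn_mk]
  have hinj : Set.InjOn Prod.fst (shiftPerm π τ '' T) ↔ Set.InjOn Prod.fst T := by
    constructor
    · intro hT p hp q hq hpq
      exact (shiftPerm π τ).injective (hT (Set.mem_image_of_mem _ hp) (Set.mem_image_of_mem _ hq)
        (congrArg π hpq))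
    · rintro hT _ ⟨p, hp, rfl⟩ _ ⟨q, hq, rfl⟩ hpq
      exact congrArg _ (hT hp hq (π.injective hpq))
  by_cases hT : Set.InjOn Prod.fst T
  · have hfin : T.Finite := .of_finite_image (Set.toFinite (Prod.fst '' T)) hT
    rw [valuationLabel, valuationLabel, if_pos (hinj.2 hT), if_pos hT, hfst,
      finsum_mem_image (shiftPerm π τ).injective.injOn]
    simp only [shiftPerm, Equiv.coe_fn_mk, Set.preimage_image_eq _ π.injective]
    rw [finsum_mem_add_distrib hfin, ← finsum_mem_image (f := fun p => τ p (Prod.fst '' T)) hT,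
      hτ, add_zero]
  · rw [valuationLabel, valuationLabel, if_neg (mt hinj.1 hT), if_neg hT]

/-- At a set `S` with a point outside `Q`, that point compensates for the values prescribed by `d`;
for the other `S` there is nothing to compensate. -/
lemma exists_correction [Finite B] (Q : Set B) (d : B → Set B → R)
    (hd : ∀ S ⊆ Q, ∑ᶠ p ∈ S, d p S = 0) :
    ∃ τ : B → Set B → R, (∀ p ∈ Q, τ p = d p) ∧ ∀ S, ∑ᶠ p ∈ S, τ p S = 0 := by
  classical
  let τ : B → Set B → R := fun p S =>
    if p ∈ Q then d p S else pointMass (S \ Q) (-∑ᶠ q ∈ S ∩ Q, d q S) p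
  have hτ : ∀ p ∈ Q, τ p = d p := fun p hp => funext fun S => if_pos hp
  refine ⟨τ, hτ, fun S => ?_⟩
  have h₁ : ∑ᶠ p ∈ S ∩ Q, τ p S = ∑ᶠ p ∈ S ∩ Q, d p S :=
    finsum_mem_congr rfl fun p hp => by rw [hτ p hp.2]
  have h₂ : ∑ᶠ p ∈ S \ Q, τ p S = -∑ᶠ p ∈ S ∩ Q, d p S := by
    obtain hS | hS := (S \ Q).eq_empty_or_nonempty
    · have hSQ := Set.sdiff_eq_empty.1 hS
      rw [hS, finsum_mem_empty, Set.inter_eq_left.2 hSQ, hd S hSQ, neg_zero]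
    · rw [← finsum_pointMass hS (-∑ᶠ p ∈ S ∩ Q, d p S)]
      exact finsum_mem_congr rfl fun p hp => if_neg hp.2
  rw [← finsum_mem_inter_add_sdiff Q (Set.toFinite S), h₁, h₂, add_neg_cancel]

theorem exists_perm_valuationLabel [Finite B] {A : Type*} {α β : A → B}
    (hα : Function.Injective α) (hβ : Function.Injective β) (ξ η : B → Set B → R)
    (h : ∀ S : Set A, ∑ᶠ p ∈ α '' S, ξ p (α '' S) = ∑ᶠ p ∈ β '' S, η p (β '' S)) :
    ∃ θ : Equiv.Perm (ValuedPoint B R), (∀ T, valuationLabel (θ '' T) = valuationLabel T) ∧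
      ∀ a, θ (α a, ξ (α a)) = (β a, η (β a)) := by
  obtain ⟨π, hπ⟩ := exists_perm_apply_eq α β fun i j => by rw [hα.eq_iff, hβ.eq_iff]
  obtain ⟨τ, hτ, hsum⟩ := exists_correction (Set.range α)
    (fun p S => η (π p) (π '' S) - ξ p S) fun S hS => by
      obtain ⟨S, rfl⟩ := Set.subset_range_iff_exists_image_eq.1 hS
      have hπS : π '' (α '' S) = β '' S := by simp only [Set.image_image, hπ]
      rw [finsum_mem_sub_distrib _ _ (Set.toFinite _), h S, ← hπS,
        finsum_mem_image (f := fun p => η p (π '' (α '' S))) π.injective.injOn, sub_self]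
  refine ⟨shiftPerm π τ, valuationLabel_shiftPerm_image π hsum, fun a => ?_⟩
  refine Prod.ext (hπ a) (funext fun S => ?_)
  simp only [shiftPerm, Equiv.coe_fn_mk, hτ _ (Set.mem_range_self a), hπ,
    Set.image_preimage_eq _ π.surjective, add_sub_cancel]

/-- The copy of `B` among the valued points in which every nonempty set `S` has label `f S`. -/
noncomputable def valuedCopy (f : Set B → R) (p : B) : ValuedPoint B R :=
  (p, fun S => pointMass S (f S) p)

lemma valuedCopy_injective (f : Set B → R) : Function.Injective (valuedCopy f) :=
  fun _ _ h => congrArg Prod.fst h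

lemma valuationLabel_valuedCopy_image (f : Set B → R) {S : Set B} (hS : S.Nonempty) :
    valuationLabel (valuedCopy f '' S) = f S := by
  have hinj : Set.InjOn Prod.fst (valuedCopy f '' S) :=
    Set.InjOn.image_of_comp (g := Prod.fst) (f := valuedCopy f) (Set.injOn_id S)
  have hfst : Prod.fst '' (valuedCopy f '' S) = S := by
    simp only [Set.image_image, valuedCopy, Set.image_id']
  rw [valuationLabel, if_pos hinj, hfst, finsum_mem_image (valuedCopy_injective f).injOn]
  exact finsum_pointMass hS (f S)

end Valuation

/-! ### Almost invariant families of copies -/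

lemma expect_mul_right {G : Type*} [Group G] {H : Subgroup G} [Fintype H] {τ : G} (hτ : τ ∈ H)
    (d : G → ℝ) : 𝔼 σ : H, d (σ * τ) = 𝔼 σ : H, d σ :=
  Fintype.expect_equiv (Equiv.mulRight ⟨τ, hτ⟩) _ _ fun _ => rfl

section LabelAverage

variable {A : Type*} {B : Type y} {R : Type*} [AddCommGroup R]

variable (B R) in
/-- The permutations of the valued points that preserve all labels. -/
def labelPerms : Subgroup (Equiv.Perm (ValuedPoint B R)) where
  carrier := {θ | ∀ T, valuationLabel (θ '' T) = valuationLabel T}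
  mul_mem' {θ η} hθ hη T := by rw [← hη T, ← hθ (η '' T), Set.image_image]; rfl
  one_mem' T := by rw [Equiv.Perm.coe_one, Set.image_id]
  inv_mem' {θ} hθ T := by
    rw [← hθ ((θ⁻¹ : Equiv.Perm _) '' T), Set.image_image]
    simp only [Equiv.Perm.coe_inv, Equiv.apply_symm_apply, Set.image_id']

/-- The average of a function of tuples of valued points over the label preserving permutations. -/
noncomputable def labelAverage [Fintype (labelPerms B R)] (c : (A → ValuedPoint B R) → ℝ)
    (ρ : A → ValuedPoint B R) : ℝ :=
  𝔼 θ : labelPerms B R, c (θ.1 ∘ ρ)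

lemma labelAverage_comp [Fintype (labelPerms B R)] (c : (A → ValuedPoint B R) → ℝ)
    (ρ : A → ValuedPoint B R) {θ : Equiv.Perm (ValuedPoint B R)} (hθ : θ ∈ labelPerms B R) :
    labelAverage c (θ ∘ ρ) = labelAverage c ρ :=
  expect_mul_right hθ fun η => c (η ∘ ρ)

lemma labelAverage_valuedCopy_comp [Finite B] [Fintype (labelPerms B R)]
    (c : (A → ValuedPoint B R) → ℝ) {α β : A → B} (hα : Function.Injective α)
    (hβ : Function.Injective β) {f g : Set B → R}
    (h : ∀ S : Set A, S.Nonempty → f (α '' S) = g (β '' S)) :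
    labelAverage c (valuedCopy f ∘ α) = labelAverage c (valuedCopy g ∘ β) := by
  obtain ⟨θ, hθ, hθ'⟩ := exists_perm_valuationLabel hα hβ (fun p S => pointMass S (f S) p)
    (fun p S => pointMass S (g S) p) fun S => by
      obtain rfl | hS := S.eq_empty_or_nonempty
      · simp only [Set.image_empty, finsum_mem_empty]
      · rw [finsum_pointMass (hS.image α), finsum_pointMass (hS.image β), h S hS]
  have hcopy : valuedCopy g ∘ β = θ ∘ valuedCopy f ∘ α := funext fun a => (hθ' a).symm
  rw [hcopy, labelAverage_comp c _ hθ]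

end LabelAverage

section LabelSimilar

variable {P : Set ℕ} {A : Type*} {κ κ' κ'' : Type*} [LinearOrder κ] [LinearOrder κ']
  [LinearOrder κ''] {lab : Set A → κ} {lab' : Set A → κ'} {lab'' : Set A → κ''}

lemma LabelSimilar.trans (h : LabelSimilar P lab lab') (h' : LabelSimilar P lab' lab'') :
    LabelSimilar P lab lab'' where
  eq_iff S T hST := (h.eq_iff S T hST).trans (h'.eq_iff S T hST)
  lt_iff S T hn hST := (h.lt_iff S T hn hST).trans (h'.lt_iff S T hn hST)

lemma labelSimilar_of_lt_iff (h : ∀ S T, lab S < lab T ↔ lab' S < lab' T) :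
    LabelSimilar P lab lab' where
  eq_iff S T _ := by simp only [le_antisymm_iff, ← not_lt, h]
  lt_iff S T _ _ := h S T

lemma labelSimilar_valuationLabel [Finite A] {R : Type*} [AddCommGroup R] [LinearOrder R]
    {θ : Equiv.Perm (ValuedPoint A R)} (hθ : θ ∈ labelPerms A R) (f : Set A → R) :
    LabelSimilar P f fun S => valuationLabel ((θ ∘ valuedCopy f) '' S) := by
  have hlab : ∀ S : Set A, S.Nonempty → valuationLabel ((θ ∘ valuedCopy f) '' S) = f S :=
    fun S hS => by rw [Set.image_comp, hθ, valuationLabel_valuedCopy_image f hS]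
  have key : ∀ S T : Set A, S.ncard = T.ncard → S = T ∨ S.Nonempty ∧ T.Nonempty :=
    fun S T hST => by
      rw [← Set.ncard_pos, ← Set.ncard_pos, ← hST, and_self]
      refine S.ncard.eq_zero_or_pos.imp_left fun h => ?_
      rw [S.ncard_eq_zero.1 h, T.ncard_eq_zero.1 (hST ▸ h)]
  refine ⟨fun S T hST => ?_, fun S T _ hST => ?_⟩
  · obtain rfl | ⟨hS, hT⟩ := key S T hST
    · simp only
    · rw [hlab S hS, hlab T hT]
  · obtain rfl | ⟨hS, hT⟩ := key S T hST
    · simp only [lt_irrefl]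
    · rw [hlab S hS, hlab T hT]

end LabelSimilar

section BlockLabel

variable {P : Set ℕ} {A : Type*} {B : Type y} [Finite B] {k : ℕ} (lab : Set B → Fin k)

variable (P B k) in
/-- The families of permutations of the labels, indexed by the sizes of subsets of `B`, that are
trivial at the sizes in `P`. -/
abbrev relabelPerms : Subgroup (Fin (Nat.card B + 1) → Equiv.Perm (Fin k)) :=
  Subgroup.pi {n | (n : ℕ) ∈ P} fun _ => ⊥

/-- The size of a set as an index. -/
noncomputable def sizeIndex (S : Set B) : Fin (Nat.card B + 1) :=
  ⟨S.ncard, Nat.lt_succ_of_le (Set.ncard_le_card S)⟩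

/-- The labels permuted by `σ`, with labels of sets of different sizes put into disjoint blocks. -/
noncomputable def blockLabel (σ : Fin (Nat.card B + 1) → Equiv.Perm (Fin k)) (S : Set B) : ℕ :=
  S.ncard * k + σ (sizeIndex S) (lab S)

lemma blockLabel_lt (σ : Fin (Nat.card B + 1) → Equiv.Perm (Fin k)) (S : Set B) :
    blockLabel lab σ S < (Nat.card B + 1) * k :=
  calc S.ncard * k + σ (sizeIndex S) (lab S) < S.ncard * k + k := by gcongr; exact Fin.is_lt _
    _ = (S.ncard + 1) * k := by ring
    _ ≤ (Nat.card B + 1) * k := by gcongr; exact Set.ncard_le_card S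

lemma blockLabel_lt_iff (σ : Fin (Nat.card B + 1) → Equiv.Perm (Fin k)) (S T : Set B) :
    blockLabel lab σ S < blockLabel lab σ T ↔ S.ncard < T.ncard ∨
      S.ncard = T.ncard ∧ σ (sizeIndex S) (lab S) < σ (sizeIndex T) (lab T) := by
  have hS := (σ (sizeIndex S) (lab S)).is_lt
  have hT := (σ (sizeIndex T) (lab T)).is_lt
  rw [blockLabel, blockLabel, Fin.lt_def]
  obtain h | h | h := lt_trichotomy S.ncard T.ncard
  · have := Nat.mul_le_mul_right k (Nat.succ_le_of_lt h)
    rw [Nat.succ_mul] at this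
    grind
  · rw [h]
    grind
  · have := Nat.mul_le_mul_right k (Nat.succ_le_of_lt h)
    rw [Nat.succ_mul] at this
    grind

lemma labelSimilar_blockLabel {σ : Fin (Nat.card B + 1) → Equiv.Perm (Fin k)}
    (hσ : σ ∈ relabelPerms P B k) : LabelSimilar P lab (blockLabel lab σ) where
  eq_iff S T hST := by
    rw [blockLabel, blockLabel, sizeIndex, sizeIndex]
    simp only [hST, Nat.add_left_cancel_iff, Fin.val_inj, EmbeddingLike.apply_eq_iff_eq]
  lt_iff S T hn hST := by
    have hS : σ (sizeIndex S) = 1 := hσ _ hn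
    have hT : σ (sizeIndex T) = 1 := hσ _ (show T.ncard ∈ P from hST ▸ hn)
    simp only [blockLabel_lt_iff, hST, hS, hT, lt_irrefl, true_and, false_or, Equiv.Perm.one_apply]

lemma exists_relabel {α β : A → B} (hα : Function.Injective α) (hβ : Function.Injective β)
    (hsim : LabelSimilar P (fun S => lab (α '' S)) fun S => lab (β '' S)) :
    ∃ τ ∈ relabelPerms P B k, ∀ σ ∈ relabelPerms P B k, ∀ S T : Set A,
      blockLabel lab (σ * τ) (α '' S) < blockLabel lab (σ * τ) (α '' T) ↔
        blockLabel lab σ (β '' S) < blockLabel lab σ (β '' T) := by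
  classical
  have hex : ∀ n : Fin (Nat.card B + 1), ∃ π : Equiv.Perm (Fin k),
      ∀ S : {S : Set A // S.ncard = n}, π (lab (α '' S.1)) = lab (β '' S.1) := fun n =>
    exists_perm_apply_eq _ _ fun S T => hsim.eq_iff S.1 T.1 (S.2.trans T.2.symm)
  choose π hπ using hex
  refine ⟨fun n => if (n : ℕ) ∈ P then 1 else π n, fun n hn => if_pos hn, fun σ hσ S T => ?_⟩
  have hsize : ∀ S : Set A, sizeIndex (α '' S) = sizeIndex (β '' S) := fun S => Fin.ext <|
    (Set.ncard_image_of_injective S hα).trans (Set.ncard_image_of_injective S hβ).symm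
  have hval : ∀ S : Set A, (sizeIndex (β '' S) : ℕ) = S.ncard := fun S =>
    Set.ncard_image_of_injective S hβ
  rw [blockLabel_lt_iff, blockLabel_lt_iff, hsize, hsize]
  simp only [Set.ncard_image_of_injective _ hα, Set.ncard_image_of_injective _ hβ, Pi.mul_apply,
    Equiv.Perm.mul_apply, hval]
  refine or_congr Iff.rfl (and_congr_right fun hST => ?_)
  by_cases hn : S.ncard ∈ P
  · have hσS : σ (sizeIndex (β '' S)) = 1 :=
      hσ _ (show (sizeIndex (β '' S) : ℕ) ∈ P by rwa [hval])
    have hσT : σ (sizeIndex (β '' T)) = 1 :=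
      hσ _ (show (sizeIndex (β '' T) : ℕ) ∈ P by rwa [hval, ← hST])
    simp only [hσS, hσT, hn, ← hST, if_true, Equiv.Perm.one_apply]
    exact hsim.lt_iff S T hn hST
  · simp only [hn, ← hST, if_false, hπ _ ⟨S, (hval S).symm⟩, hπ _ ⟨T, (hval T).symm⟩]

end BlockLabel

section AlmostInvariant

variable {P : Set ℕ} {A ι J : Type*} {B : Type y} [Finite A] [Finite B] [Finite J] {k : ℕ}

lemma ofNat_lt_ofNat_iff {K m n : ℕ} (hm : m < K) (hn : n < K) :
    Fin.ofNat (K + 1) m < Fin.ofNat (K + 1) n ↔ m < n := by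
  rw [Fin.lt_def, Fin.val_ofNat, Fin.val_ofNat, Nat.mod_eq_of_lt (hm.trans K.lt_succ_self),
    Nat.mod_eq_of_lt (hn.trans K.lt_succ_self)]

/-- Averaging over the label preserving permutations turns a bounded function of tuples into a
function of labellings; a strictly monotone relabelling makes that function almost constant on
order types. -/
lemma exists_relabelling (lab : Set B → Fin k) {α₀ : A → B} (hα₀ : Function.Injective α₀) (C : ℝ)
    {ε : ℝ} (hε : 0 < ε) :
    ∃ K : ℕ, ∀ [Fintype (labelPerms B (Fin (K + 1)))]
      (c : J → (A → ValuedPoint B (Fin (K + 1))) → ℝ), (∀ j ρ, |c j ρ| ≤ C) →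
      ∃ f : (Fin (Nat.card B + 1) → Equiv.Perm (Fin k)) → Set B → Fin (K + 1),
        (∀ σ S T, blockLabel lab σ S < blockLabel lab σ T ↔ f σ S < f σ T) ∧
        ∀ {α β : A → B}, Function.Injective α → Function.Injective β → ∀ σ τ,
          (∀ S T, blockLabel lab σ (α '' S) < blockLabel lab σ (α '' T) ↔
            blockLabel lab τ (β '' S) < blockLabel lab τ (β '' T)) →
          ∀ j, |labelAverage (c j) (valuedCopy (f σ) ∘ α) -
            labelAverage (c j) (valuedCopy (f τ) ∘ β)| ≤ ε := by
  obtain ⟨K, hK⟩ := exists_bound_strictMono_approx (Set A) J ((Nat.card B + 1) * k) C hε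
  refine ⟨K, fun c hc => ?_⟩
  obtain ⟨h, hmono, hbound, hh⟩ := hK (fun p j => labelAverage (c j)
    (valuedCopy (fun S => Fin.ofNat (K + 1) (p (α₀ ⁻¹' S))) ∘ α₀)) fun p j =>
      abs_expect_le_of_forall_abs_le fun θ => hc j _
  refine ⟨fun σ S => Fin.ofNat (K + 1) (h (blockLabel lab σ S)), fun σ S T => ?_,
    fun {α β} hα hβ σ τ hlt j => ?_⟩
  · rw [ofNat_lt_ofNat_iff (hbound _ (blockLabel_lt lab σ S)) (hbound _ (blockLabel_lt lab σ T)),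
      hmono.lt_iff_lt]
  · have hcopy : ∀ {β : A → B}, Function.Injective β → ∀ σ,
        labelAverage (c j) (valuedCopy (fun S => Fin.ofNat (K + 1) (h (blockLabel lab σ S))) ∘ β) =
          labelAverage (c j) (valuedCopy (fun S => Fin.ofNat (K + 1)
            ((h ∘ fun T => blockLabel lab σ (β '' T)) (α₀ ⁻¹' S))) ∘ α₀) := fun hβ σ =>
      labelAverage_valuedCopy_comp (c j) hβ hα₀ fun S _ => by
        rw [Set.preimage_image_eq _ hα₀]
        rfl
    rw [hcopy hα, hcopy hβ]
    exact hh _ _ (fun _ => blockLabel_lt lab _ _) (fun _ => blockLabel_lt lab _ _) hlt j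

theorem exists_almost_invariant_copies (lab : Set B → Fin k) {α₀ : A → B} {α : ι → A → B}
    (hα₀ : Function.Injective α₀) (hα : ∀ i, Function.Injective (α i))
    (hsim : ∀ i, LabelSimilar P (fun S => lab (α₀ '' S)) fun S => lab (α i '' S))
    (C : ℝ) {ε : ℝ} (hε : 0 < ε) :
    ∃ K : ℕ, ∀ c : J → (A → ValuedPoint B (Fin (K + 1))) → ℝ, (∀ j ρ, |c j ρ| ≤ C) →
      ∃ (I : Type y) (_ : Fintype I) (_ : Nonempty I)
        (b : I → B → ValuedPoint B (Fin (K + 1))), (∀ l, Function.Injective (b l)) ∧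
        (∀ l, LabelSimilar P lab fun S => valuationLabel (b l '' S)) ∧
        ∀ i j, |𝔼 l, c j (b l ∘ α i) - 𝔼 l, c j (b l ∘ α₀)| ≤ ε := by
  classical
  obtain ⟨K, hK⟩ := exists_relabelling (J := J) lab hα₀ C hε
  refine ⟨K, fun c hc => ?_⟩
  have := Fintype.ofFinite (labelPerms B (Fin (K + 1)))
  have := Fintype.ofFinite (relabelPerms P B k)
  obtain ⟨f, hf, happrox⟩ := hK c hc
  refine ⟨relabelPerms P B k × labelPerms B (Fin (K + 1)), inferInstance, inferInstance,
    fun z => z.2.1 ∘ valuedCopy (f z.1.1),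
    fun z => z.2.1.injective.comp (valuedCopy_injective _),
    fun z => ((labelSimilar_blockLabel lab z.1.2).trans (labelSimilar_of_lt_iff (hf z.1.1))).trans
      (labelSimilar_valuationLabel z.2.2 _), fun i j => ?_⟩
  let d : (A → B) → (Fin (Nat.card B + 1) → Equiv.Perm (Fin k)) → ℝ := fun β σ =>
    labelAverage (c j) (valuedCopy (f σ) ∘ β)
  have havg : ∀ β : A → B, 𝔼 z : relabelPerms P B k × labelPerms B (Fin (K + 1)),
      c j ((z.2.1 ∘ valuedCopy (f z.1.1)) ∘ β) = 𝔼 σ : relabelPerms P B k, d β σ.1 := fun β =>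
    Finset.expect_product _ _ _
  obtain ⟨τ, hτ, hlt⟩ := exists_relabel lab hα₀ (hα i) (hsim i)
  have hshift : 𝔼 σ : relabelPerms P B k, d α₀ (σ.1 * τ) = 𝔼 σ : relabelPerms P B k, d α₀ σ.1 :=
    expect_mul_right hτ (d α₀)
  rw [havg, havg, ← hshift, ← Finset.expect_sub_distrib]
  exact abs_expect_le_of_forall_abs_le fun σ =>
    happrox (hα i) hα₀ σ.1 (σ.1 * τ) (fun S T => (hlt σ.1 σ.2 S T).symm) j

end AlmostInvariant

/-! ### Amenability -/

section Continuous

variable {L : FirstOrder.Language.{u, v}} {M : Type w} [L.Structure M]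

lemma exists_finset_forall_mem_of_isOpen {U : Set (Aut L M)} (hU : IsOpen U) {g : Aut L M}
    (hg : g ∈ U) : ∃ A : Finset M, ∀ h : Aut L M, (∀ a ∈ A, h a = g a) → h ∈ U := by
  classical
  induction hU with
  | basic V hV =>
    obtain ⟨a, b, rfl⟩ := hV
    exact ⟨{a}, fun h hh => (hh a (Finset.mem_singleton_self a)).trans hg⟩
  | univ => exact ⟨∅, fun _ _ => trivial⟩
  | inter V W _ _ hV hW =>
    obtain ⟨A, hA⟩ := hV hg.1
    obtain ⟨B, hB⟩ := hW hg.2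
    exact ⟨A ∪ B, fun h hh => ⟨hA h fun a ha => hh a (Finset.mem_union_left _ ha),
      hB h fun a ha => hh a (Finset.mem_union_right _ ha)⟩⟩
  | sUnion 𝒱 _ ih =>
    obtain ⟨V, hV, hg⟩ := hg
    obtain ⟨A, hA⟩ := ih V hV hg
    exact ⟨A, fun h hh => ⟨V, hV, hA h hh⟩⟩

variable {X : Type x} [MulAction (Aut L M) X]

lemma exists_finset_forall_abs_sub_le [TopologicalSpace X] [CompactSpace X]
    [ContinuousSMul (Aut L M) X] {f : X → ℝ} (hf : Continuous f) {ε : ℝ} (hε : 0 < ε) :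
    ∃ A : Finset M, ∀ g : Aut L M, (∀ a ∈ A, g a = a) → ∀ p, |f (g • p) - f p| ≤ ε := by
  let W : Set (Aut L M × X) := {z | |f (z.1 • z.2) - f z.2| < ε}
  have hW : IsOpen W := isOpen_lt
    ((hf.comp continuous_smul).sub (hf.comp continuous_snd)).abs continuous_const
  have hsub : ({1} : Set (Aut L M)) ×ˢ (Set.univ : Set X) ⊆ W := by
    rintro ⟨g, p⟩ ⟨rfl, -⟩
    simpa only [W, Set.mem_ofPred_eq, one_smul, sub_self, abs_zero] using hε
  obtain ⟨U, V, hU, -, h1U, hV, hUV⟩ :=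
    generalized_tube_lemma isCompact_singleton isCompact_univ hW hsub
  obtain ⟨A, hA⟩ := exists_finset_forall_mem_of_isOpen hU (h1U rfl)
  refine ⟨A, fun g hg p => ?_⟩
  have hgp : (g, p) ∈ W := hUV ⟨hA g hg, hV trivial⟩
  exact hgp.le

lemma exists_finset_forall_mem_abs_sub_le [TopologicalSpace X] [CompactSpace X]
    [ContinuousSMul (Aut L M) X] (Φ : Finset C_c(X, ℝ)) {ε : ℝ} (hε : 0 < ε) :
    ∃ A : Finset M, ∀ f ∈ Φ, ∀ g : Aut L M, (∀ a ∈ A, g a = a) →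
      ∀ p, |f (g • p) - f p| ≤ ε := by
  classical
  choose A hA using fun f : C_c(X, ℝ) =>
    exists_finset_forall_abs_sub_le (L := L) (M := M) f.continuous hε
  exact ⟨Φ.biUnion A, fun f hf g hg =>
    hA f g fun a ha => hg a (Finset.mem_biUnion.2 ⟨f, hf, ha⟩)⟩

/-- Two automorphisms that agree on `A` differ by an element of the stabilizer of `A` on the right,
which acts on the left on the points `g⁻¹ • p₀`. -/
lemma exists_tuple_function (p₀ : X) (f : X → ℝ) {A : Finset M} {ε C : ℝ} (hC : ∀ p, |f p| ≤ C)
    (hA : ∀ g : Aut L M, (∀ a ∈ A, g a = a) → ∀ p, |f (g • p) - f p| ≤ ε) :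
    ∃ c : (A → M) → ℝ, (∀ ρ, |c ρ| ≤ C) ∧
      ∀ g : Aut L M, |f (g⁻¹ • p₀) - c (g ∘ Subtype.val)| ≤ ε := by
  let r : Aut L M → A → M := fun g => g ∘ Subtype.val
  refine ⟨fun ρ => f ((Function.invFun r ρ)⁻¹ • p₀), fun ρ => hC _, fun g => ?_⟩
  let g' := Function.invFun r (r g)
  have hg' : ∀ a ∈ A, g' a = g a := fun a ha =>
    congrFun (Function.invFun_eq (f := r) ⟨g, rfl⟩) ⟨a, ha⟩
  have h := hA (g⁻¹ * g') (fun a ha => (congrArg g.symm (hg' a ha)).trans (g.symm_apply_apply a))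
    (g'⁻¹ • p₀)
  rwa [mul_smul, smul_inv_smul] at h

end Continuous

section Amenable

variable {P : Set ℕ} {hP : ∀ n ∈ P, 3 ≤ n} {M : Type w} [Countable M] [(langP P).Structure M]

lemma exists_almost_invariant_auts (hM : IsFraisseLimit (classK.{w} P hP) M) {A J : Type*}
    [Finite A] [Finite J] {a : A → M} (ha : Function.Injective a) (F : Finset (Aut (langP P) M))
    {c : J → (A → M) → ℝ} {C : ℝ} (hc : ∀ j ρ, |c j ρ| ≤ C) {ε : ℝ} (hε : 0 < ε) :
    ∃ (I : Type w) (_ : Fintype I) (_ : Nonempty I) (g : I → Aut (langP P) M), ∀ s ∈ F, ∀ j,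
      |𝔼 i, c j (⇑(g i * s⁻¹) ∘ a) - 𝔼 i, c j (g i ∘ a)| ≤ ε := by
  let B : Set M := Set.range a ∪ Set.range fun z : F × A => z.1.1⁻¹ (a z.2)
  obtain ⟨k, lab, hlab⟩ := (isKStructure_of_isFraisseLimit hM).exists_isLabelledBy
    (Subtype.val_injective (p := (· ∈ B)))
  let α₀ : A → B := fun x => ⟨a x, Or.inl ⟨x, rfl⟩⟩
  let α : F → A → B := fun s x => ⟨s.1⁻¹ (a x), Or.inr ⟨(s, x), rfl⟩⟩
  have hα₀ : Function.Injective α₀ := fun x y h => ha (congrArg Subtype.val h)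
  have hα : ∀ s, Function.Injective (α s) := fun s x y h =>
    ha (s.1⁻¹.injective (congrArg Subtype.val h))
  have hsim : ∀ s, LabelSimilar P (fun S => lab (α₀ '' S)) fun S => lab (α s '' S) := fun s =>
    ((hlab.comp hα₀).map s.1⁻¹.toEmbedding).labelSimilar (hlab.comp (hα s))
  obtain ⟨K, hK⟩ := exists_almost_invariant_copies (J := J) lab hα₀ hα hsim C hε
  obtain ⟨e, he⟩ := exists_isLabelledBy hM
    (valuationLabel : Set (ValuedPoint B (Fin (K + 1))) → Fin (K + 1))
  obtain ⟨I, hI, hI', b, hb, hbsim, havg⟩ := hK (fun j ρ => c j (e ∘ ρ)) fun j ρ => hc j _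
  choose g hg using fun l => hlab.exists_aut hM.ultrahomogeneous (he.comp (hb l)) (hbsim l)
  refine ⟨I, hI, hI', g, fun s hs j => ?_⟩
  have hg₀ : ∀ l, g l ∘ a = e ∘ b l ∘ α₀ := fun l => funext fun x => hg l (α₀ x)
  have hgs : ∀ l, ⇑(g l * s⁻¹) ∘ a = e ∘ b l ∘ α ⟨s, hs⟩ := fun l =>
    funext fun x => hg l (α ⟨s, hs⟩ x)
  simp only [hg₀, hgs]
  exact havg ⟨s, hs⟩ j

theorem exists_almost_invariant_points (hM : IsFraisseLimit (classK.{w} P hP) M) {X : Type x}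
    [TopologicalSpace X] [CompactSpace X] [Nonempty X] [MulAction (Aut (langP P) M) X]
    [ContinuousSMul (Aut (langP P) M) X] (F : Finset (Aut (langP P) M)) (Φ : Finset C_c(X, ℝ))
    {ε : ℝ} (hε : 0 < ε) :
    ∃ (I : Type w) (_ : Fintype I) (_ : Nonempty I) (y : I → X), ∀ s ∈ F, ∀ f ∈ Φ,
      |𝔼 i, f (s • y i) - 𝔼 i, f (y i)| ≤ ε := by
  obtain ⟨p₀⟩ := ‹Nonempty X›
  have hε' : 0 < ε / 3 := by positivity
  obtain ⟨A, hA⟩ := exists_finset_forall_mem_abs_sub_le (L := langP P) (M := M) Φ hε'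
  obtain ⟨C, hC⟩ := exists_forall_mem_abs_le Φ
  choose c hcC hc using fun f : Φ => exists_tuple_function p₀ f.1 (hC f.1 f.2) (hA f.1 f.2)
  obtain ⟨I, hI, hI', g, hg⟩ := exists_almost_invariant_auts hM
    (Subtype.val_injective (p := (· ∈ A))) F hcC hε'
  refine ⟨I, hI, hI', fun i => (g i)⁻¹ • p₀, fun s hs f hf => ?_⟩
  have hs' : |𝔼 i, f (s • (g i)⁻¹ • p₀) - 𝔼 i, c ⟨f, hf⟩ (⇑(g i * s⁻¹) ∘ Subtype.val)| ≤ ε / 3 := by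
    rw [← Finset.expect_sub_distrib]
    refine abs_expect_le_of_forall_abs_le fun i => ?_
    have h := hc ⟨f, hf⟩ (g i * s⁻¹)
    rwa [mul_inv_rev, inv_inv, mul_smul] at h
  have h₁ : |𝔼 i, f ((g i)⁻¹ • p₀) - 𝔼 i, c ⟨f, hf⟩ (g i ∘ Subtype.val)| ≤ ε / 3 := by
    rw [← Finset.expect_sub_distrib]
    exact abs_expect_le_of_forall_abs_le fun i => hc ⟨f, hf⟩ (g i)
  have h₂ := hg s hs ⟨f, hf⟩
  rw [abs_le] at hs' h₁ h₂ ⊢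
  constructor <;> linarith

theorem isAmenable_aut (hM : IsFraisseLimit (classK.{w} P hP) M) :
    IsAmenable.{w, x} (Aut (langP P) M) :=
  fun _ _ _ _ _ _ _ _ _ =>
    exists_invariant_measure fun F Φ _ => exists_almost_invariant_points hM F Φ

end Amenable

end GenericOrders

theorem theorem2_general (P : Set ℕ) (hP : ∀ n ∈ P, 3 ≤ n)
    (M : Type w) [Countable M] [(langP P).Structure M]
    (hM : IsFraisseLimit (classK.{w} P hP) M) :
    IsAmenable.{w, x} (Aut (langP P) M) ∧
    (P.Nonempty → ¬ HrushovskiExtension (langP P) M) ∧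
    (¬ ∃ o : LinearOrder M,
      letI := orderExpansion (langP P) M o
      ((langP P).sum FirstOrder.Language.order).IsUltrahomogeneous M ∧
        IsExtremelyAmenable.{w, x} (Aut ((langP P).sum FirstOrder.Language.order) M)) ∧
    (∀ (L' : FirstOrder.Language.{u, v}) [L'.IsRelational] [L'.Structure M]
      (φ : langP P →ᴸ L') [φ.IsExpansionOn M],
      IsPrecompactExpansion φ M → HasQE L' M → IsExtremelyAmenable.{w, x} (Aut L' M) →
      ∀ (n : ℕ) (hn : 0 < n), ¬ ∃ a : Fin 6 → (Fin n → M), IsIncreasingZ4 P L' n hn a) :=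
  ⟨isAmenable_aut hM, fun hne => not_hrushovskiExtension hne hM, not_exists_linearOrder hM,
    fun _ _ _ φ _ => not_exists_isIncreasingZ4 hM φ⟩

theorem theorem2 (P : Set ℕ) (hP : ∀ n ∈ P, 3 ≤ n) (hne : P.Nonempty)
    (M : Type w) [Countable M] [(langP P).Structure M]
    (hM : IsFraisseLimit (classK.{w} P hP) M) :
    IsAmenable.{w, x} (Aut (langP P) M) ∧
    ¬ HrushovskiExtension (langP P) M ∧
    (¬ ∃ o : LinearOrder M,
      letI := orderExpansion (langP P) M o
      ((langP P).sum FirstOrder.Language.order).IsUltrahomogeneous M ∧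
        IsExtremelyAmenable.{w, x} (Aut ((langP P).sum FirstOrder.Language.order) M)) ∧
    (∀ (L' : FirstOrder.Language.{u, v}) [L'.IsRelational] [L'.Structure M]
      (φ : langP P →ᴸ L') [φ.IsExpansionOn M],
      IsPrecompactExpansion φ M → HasQE L' M → IsExtremelyAmenable.{w, x} (Aut L' M) →
      ∀ (n : ℕ) (hn : n ∈ P), 2 * n ∉ P →
        ¬ ∃ a : Fin 6 → (Fin n → M),
          IsIncreasingZ4 P L' n (Nat.lt_of_lt_of_le (by decide) (hP n hn)) a) := by
  obtain ⟨hamenable, hext, horder, hZ4⟩ := theorem2_general.{u, v, w, x} P hP M hM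
  exact ⟨hamenable, hext hne, horder,
    fun L' _ _ φ _ hpre hqe hG n hn _ => hZ4 L' φ hpre hqe hG n _⟩
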